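/- Let $\mathbb H^2$ be the oriented hyperbolic plane (the upper half-plane with the metric $y^{-2}(dx^2+dy^2)$ and its standard orientation), and let $\mathrm{Isom}^+(\mathbb H^2)$ be its group of orientation preserving isometries, with the topology of pointwise convergence. Fix a point $p\in\mathbb H^2$ and a unit tangent vector $v$ at $p$. Let $R$ be the clockwise rotation by a right angle fixing $p$, for $r>0$ let $A_r$ be the translation of distance $r$ along the positive direction of the geodesic with initial condition $v$, and let $G_r\subset \mathrm{Isom}^+(\mathbb H^2)$ be the group generated by $R$ and $A_r$. For each integer $n\ge 5$ put $$r_n=\operatorname{acosh}\bigl(1+2\cos(2\pi/n)\bigr),$$ and let $T_n$ be the (solid, compact) geodesic triangle with vertices $p,q,s$ such that the side $[p,q]$ leaves $p$ in direction $v$, the side $[p,s]$ leaves $p$ in the direction obtained from $v$ by a clockwise turn of angle $\pi/4$, and the interior angles at $p,q,s$ are $\pi/4,\pi/4,2\pi/n$ respectively. **Proposition.** For each $n\ge 5$ the group $G_{r_n}$ is discrete, a triangle $T_n$ as above exists, and every such triangle $T_n$ is a fundamental domain for $G_{r_n}$: the translates $g(T_n)$, $g\in G_{r_n}$, cover $\mathbb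 H^2$, and for distinct $g,h\in G_{r_n}$ the translate $g(T_n)$ contains no interior point of $h(T_n)$. -/

import Mathlib

namespace HypTurtle

open UpperHalfPlane

/-!
The hyperbolic plane is the upper half-plane `ℍ` with Mathlib's hyperbolic distance and the
orientation of `ℂ`. The metric is `|dz|² / (im z)²`, hence conformal: a tangent vector at `p` is a
complex number `v`, of hyperbolic length `‖v‖ / im p`, and hyperbolic angles between tangent vectors
at `p` are Euclidean angles.
-/

/-- Unit tangent vectors of the hyperbolic plane at `p`. -/
def UnitTangent (p : ℍ) : Type := {v : ℂ // ‖v‖ = p.im}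

/-- The tangent vector `v` turned clockwise through the angle `θ`. -/
noncomputable def UnitTangent.turnCW {p : ℍ} (v : UnitTangent p) (θ : ℝ) : UnitTangent p :=
  ⟨Complex.exp (-(θ * Complex.I)) * v.1, by
    have h : -((θ : ℂ) * Complex.I) = ((-θ : ℝ) : ℂ) * Complex.I := by push_cast; ring
    rw [norm_mul, h, Complex.norm_exp_ofReal_mul_I, one_mul, v.2]⟩

/-! ### Orientation preserving isometries -/

/-- The action of `SL(2, ℝ)` on `ℍ` by the isometries `z ↦ (az + b) / (cz + d)`. -/
noncomputable def moebius : Matrix.SpecialLinearGroup (Fin 2) ℝ →* (ℍ ≃ᵢ ℍ) where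
  toFun g := IsometryEquiv.constSMul g
  map_one' := by ext z; simp
  map_mul' g h := by ext z; simp [mul_smul]

/-- The group of orientation preserving isometries of the hyperbolic plane: the Möbius
transformations with real coefficients and determinant one. -/
noncomputable def IsomPlus : Subgroup (ℍ ≃ᵢ ℍ) := moebius.range

/-- The topology of pointwise convergence. -/
noncomputable instance : TopologicalSpace IsomPlus :=
  TopologicalSpace.induced (fun (g : IsomPlus) (z : ℍ) => g.1 z) inferInstance

/-- The matrix `g`, chosen up to sign, with `g • i = p` and with derivative at `i` taking the
upward unit vector `i` to `v`; its bottom row is given by `(c i + d)² = i / v`. -/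
noncomputable def frame (p : ℍ) (v : UnitTangent p) : Matrix.SpecialLinearGroup (Fin 2) ℝ :=
  ⟨!![((p : ℂ) * (Complex.I / v.1) ^ (1 / 2 : ℂ)).im, ((p : ℂ) * (Complex.I / v.1) ^ (1 / 2 : ℂ)).re;
      ((Complex.I / v.1) ^ (1 / 2 : ℂ)).im, ((Complex.I / v.1) ^ (1 / 2 : ℂ)).re], by
    have hp : 0 < p.im := p.im_pos
    have h2 : ((Complex.I / v.1) ^ (1 / 2 : ℂ)) ^ 2 = Complex.I / v.1 := by
      rw [one_div]; exact Complex.cpow_nat_inv_pow _ two_ne_zero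
    set u := (Complex.I / v.1) ^ (1 / 2 : ℂ)
    have h3 : ‖u‖ ^ 2 = 1 / p.im := by
      rw [← norm_pow, h2, norm_div, Complex.norm_I, v.2]
    rw [← Complex.normSq_eq_norm_sq, Complex.normSq_apply] at h3
    have h4 : p.im * (u.re * u.re + u.im * u.im) = 1 := by rw [h3]; field_simp
    rw [Matrix.det_fin_two_of]
    simp only [Complex.mul_im, Complex.mul_re, coe_re, coe_im]
    linarith⟩

/-- The diagonal matrix that translates the imaginary axis upwards by the distance `t`. -/
noncomputable def diagMat (t : ℝ) : Matrix.SpecialLinearGroup (Fin 2) ℝ :=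
  ⟨!![Real.exp (t / 2), 0; 0, Real.exp (-(t / 2))], by
    rw [Matrix.det_fin_two_of, ← Real.exp_add]; simp⟩

/-- The matrix that acts on `ℍ` as the clockwise rotation about `i` of angle `2 θ`. -/
noncomputable def rotMat (θ : ℝ) : Matrix.SpecialLinearGroup (Fin 2) ℝ :=
  ⟨!![Real.cos θ, -Real.sin θ; Real.sin θ, Real.cos θ], by
    rw [Matrix.det_fin_two_of]; nlinarith [Real.sin_sq_add_cos_sq θ]⟩

/-- The unit speed geodesic with initial point `p` and initial velocity `v`. -/
noncomputable def geodesic (p : ℍ) (v : UnitTangent p) (t : ℝ) : ℍ :=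
  frame p v • (diagMat t • UpperHalfPlane.I)

/-- `A_r`: the translation of distance `r` along the positive direction of the geodesic with initial
condition `v`. -/
noncomputable def translation (p : ℍ) (v : UnitTangent p) (r : ℝ) : IsomPlus :=
  ⟨moebius (frame p v * diagMat r * (frame p v)⁻¹), ⟨_, rfl⟩⟩

/-- `R`: the clockwise rotation by a right angle fixing `p`. (It does not depend on `v`.) -/
noncomputable def quarterTurn (p : ℍ) (v : UnitTangent p) : IsomPlus :=
  ⟨moebius (frame p v * rotMat (Real.pi / 4) * (frame p v)⁻¹), ⟨_, rfl⟩⟩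

/-- `G_r`: the group generated by `R` and `A_r`. -/
noncomputable def turtleGroup (p : ℍ) (v : UnitTangent p) (r : ℝ) : Subgroup IsomPlus :=
  Subgroup.closure {quarterTurn p v, translation p v r}

/-- `r_n = acosh (1 + 2 cos (2π / n))`. -/
noncomputable def sideLength (n : ℕ) : ℝ := Real.arcosh (1 + 2 * Real.cos (2 * Real.pi / n))

/-! ### Geodesic triangles -/

/-- The geodesic segment between `a` and `b`. -/
def segment (a b : ℍ) : Set ℍ := {z | dist a z + dist z b = dist a b}

/-- The (solid, closed) geodesic triangle with vertices `a`, `b`, `c`: the union of the geodesic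
segments from `a` to the points of the opposite side. -/
def triangle (a b c : ℍ) : Set ℍ := {z | ∃ x ∈ segment b c, z ∈ segment a x}

/-- The geodesic with initial condition `u` at `a` passes through `b` at a positive time: `u` is the
direction at `a` of the side from `a` to `b`. -/
def Points (a : ℍ) (u : UnitTangent a) (b : ℍ) : Prop := ∃ t : ℝ, 0 < t ∧ geodesic a u t = b

/-- The interior angle at the vertex `a` between the sides from `a` to `b` and from `a` to `c`
is `α`. -/
def HasAngle (a b c : ℍ) (α : ℝ) : Prop :=
  ∃ u w : UnitTangent a, Points a u b ∧ Points a w c ∧ InnerProductGeometry.angle u.1 w.1 = α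

/-- `p`, `q`, `s` are the vertices of `T_n`: the triangle with a vertex at `p`, whose edges `[p, q]`
and `[p, s]` have the directions `v` and `w`, where `w` is `v` turned clockwise by `π / 4`, with
interior angles `π / 4`, `π / 4`, `2π / n` at `p`, `q`, `s`. -/
structure IsPolygonTriangle (n : ℕ) (p : ℍ) (v : UnitTangent p) (q s : ℍ) : Prop where
  dir_q : Points p v q
  dir_s : Points p (v.turnCW (Real.pi / 4)) s
  angle_p : HasAngle p q s (Real.pi / 4)
  angle_q : HasAngle q p s (Real.pi / 4)
  angle_s : HasAngle s p q (2 * Real.pi / n)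

/-! ### Fundamental domains -/

/-- The translate `g P`. -/
def translate (g : IsomPlus) (P : Set ℍ) : Set ℍ := (fun z => g.1 z) '' P

/-- `P` is a fundamental domain for `G`: the translates of `P` cover the plane, and translates
by distinct elements do not meet at an interior point. -/
structure IsFundDomain (G : Subgroup IsomPlus) (P : Set ℍ) : Prop where
  cover : ⋃ g ∈ G, translate g P = Set.univ
  disjoint_interior : ∀ g ∈ G, ∀ h ∈ G, g ≠ h →
    Disjoint (translate g P) (interior (translate h P))

/-! ### The explicit formulas above have the defining properties -/

theorem frame_denom_sq (p : ℍ) (v : UnitTangent p) :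
    (((frame p v) 1 0 : ℂ) * Complex.I + (frame p v) 1 1) ^ 2 = Complex.I / v.1 := by
  have h2 : ((Complex.I / v.1) ^ (1 / 2 : ℂ)) ^ 2 = Complex.I / v.1 := by
    rw [one_div]; exact Complex.cpow_nat_inv_pow _ two_ne_zero
  conv_rhs => rw [← h2]
  congr 1
  simp only [frame, Matrix.SpecialLinearGroup.coe_mk, Matrix.of_apply, Matrix.cons_val]
  rw [add_comm]; exact Complex.re_add_im _

theorem frame_smul_I (p : ℍ) (v : UnitTangent p) : frame p v • UpperHalfPlane.I = p := by
  have hv : v.1 ≠ 0 := by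
    intro h
    have := v.2
    rw [h, norm_zero] at this
    exact p.im_pos.ne this
  have h0 : ((frame p v) 1 0 : ℂ) * Complex.I + (frame p v) 1 1 ≠ 0 := by
    intro h
    have := frame_denom_sq p v
    rw [h] at this
    exact div_ne_zero Complex.I_ne_zero hv (by rw [← this]; simp)
  apply UpperHalfPlane.ext
  rw [coe_specialLinearGroup_apply]
  simp only [Algebra.algebraMap_self, RingHom.id_apply, coe_I]
  rw [div_eq_iff h0]
  simp only [frame, Matrix.SpecialLinearGroup.coe_mk, Matrix.of_apply, Matrix.cons_val]
  rw [add_comm, Complex.re_add_im, add_comm, Complex.re_add_im]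

theorem diagMat_smul_I (t : ℝ) :
    ((diagMat t • UpperHalfPlane.I : ℍ) : ℂ) = Complex.exp t * Complex.I := by
  rw [coe_specialLinearGroup_apply]
  simp only [diagMat, Matrix.SpecialLinearGroup.coe_mk, Matrix.of_apply, Matrix.cons_val,
    Algebra.algebraMap_self, RingHom.id_apply, coe_I, Complex.ofReal_zero, zero_mul, zero_add,
    add_zero, Complex.ofReal_exp]
  rw [mul_div_right_comm, ← Complex.exp_sub]
  congr 2
  push_cast
  ring

theorem hasDerivAt_smul (g : Matrix.SpecialLinearGroup (Fin 2) ℝ) (z : ℝ → ℍ) (w : ℂ)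
    (hz : z 0 = UpperHalfPlane.I) (h : HasDerivAt (fun t => (z t : ℂ)) w 0) :
    HasDerivAt (fun t => ((g • z t : ℍ) : ℂ)) (w / ((g 1 0 : ℂ) * Complex.I + g 1 1) ^ 2) 0 := by
  have h0 : (g 1 0 : ℂ) * z 0 + g 1 1 ≠ 0 := by
    simpa [denom] using denom_ne_zero (g : Matrix.GeneralLinearGroup (Fin 2) ℝ) (z 0)
  have hd : (g 0 0 : ℂ) * g 1 1 - g 0 1 * g 1 0 = 1 := by
    have := g.2
    rw [Matrix.det_fin_two] at this
    exact_mod_cast this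
  simp only [coe_specialLinearGroup_apply, Algebra.algebraMap_self, RingHom.id_apply]
  have := ((h.const_mul (g 0 0 : ℂ)).add_const (g 0 1 : ℂ)).div
    ((h.const_mul (g 1 0 : ℂ)).add_const (g 1 1 : ℂ)) h0
  rw [hz, coe_I] at this
  refine this.congr_deriv ?_
  congr 1
  linear_combination w * hd

theorem diagMat_hasDerivAt :
    HasDerivAt (fun t : ℝ => ((diagMat t • UpperHalfPlane.I : ℍ) : ℂ)) Complex.I 0 := by
  simp only [diagMat_smul_I]
  have h : HasDerivAt (fun t : ℝ => Complex.exp (t : ℂ)) 1 0 := by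
    simpa using (Complex.ofRealCLM.hasDerivAt (x := (0 : ℝ))).cexp
  simpa using h.mul_const Complex.I

theorem diagMat_zero_smul : diagMat 0 • UpperHalfPlane.I = UpperHalfPlane.I := by
  apply UpperHalfPlane.ext
  rw [diagMat_smul_I]
  simp

theorem diagMat_mul (r t : ℝ) : diagMat r * diagMat t = diagMat (t + r) := by
  apply Subtype.ext
  change !![Real.exp (r / 2), 0; 0, Real.exp (-(r / 2))] *
    !![Real.exp (t / 2), 0; 0, Real.exp (-(t / 2))] =
    !![Real.exp ((t + r) / 2), 0; 0, Real.exp (-((t + r) / 2))]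
  have h1 : (t + r) / 2 = r / 2 + t / 2 := by ring
  rw [Matrix.mul_fin_two, h1, neg_add, Real.exp_add, Real.exp_add]
  simp

/-- `geodesic p v` is a unit speed, globally minimizing curve starting at `p`. -/
theorem geodesic_isometry (p : ℍ) (v : UnitTangent p) :
    Isometry (geodesic p v) ∧ geodesic p v 0 = p := by
  refine ⟨?_, by rw [geodesic, diagMat_zero_smul, frame_smul_I]⟩
  refine (isometry_smul ℍ (frame p v)).comp (f := fun t => diagMat t • UpperHalfPlane.I) ?_
  convert isometry_vertical_line 0 using 2 with t
  apply UpperHalfPlane.ext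
  rw [diagMat_smul_I, ← Complex.ofReal_exp]
  apply Complex.ext <;> simp [-Complex.ofReal_exp]

/-- The initial velocity of `geodesic p v` is `v`. -/
theorem geodesic_hasDerivAt (p : ℍ) (v : UnitTangent p) :
    HasDerivAt (fun t => (geodesic p v t : ℂ)) v.1 0 := by
  have := hasDerivAt_smul (frame p v) _ _ diagMat_zero_smul diagMat_hasDerivAt
  rwa [frame_denom_sq, div_div_cancel₀ Complex.I_ne_zero] at this

/-- `A_r` advances the geodesic by `r`. -/
theorem translation_geodesic (p : ℍ) (v : UnitTangent p) (r t : ℝ) :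
    (translation p v r).1 (geodesic p v t) = geodesic p v (t + r) := by
  change (frame p v * diagMat r * (frame p v)⁻¹) • (frame p v • (diagMat t • UpperHalfPlane.I)) = _
  rw [mul_smul, inv_smul_smul, mul_smul, ← mul_smul (diagMat r), diagMat_mul, geodesic]

/-- `R` fixes `p` and turns `v` clockwise by a right angle. -/
theorem quarterTurn_geodesic (p : ℍ) (v : UnitTangent p) :
    (quarterTurn p v).1 p = p ∧
    HasDerivAt (fun t => ((quarterTurn p v).1 (geodesic p v t) : ℂ)) (-Complex.I * v.1) 0 := by
  have hs : ((Real.sqrt 2 : ℝ) : ℂ) ^ 2 = 2 := by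
    rw [← Complex.ofReal_pow, Real.sq_sqrt (by norm_num)]; norm_num
  have hr : (((rotMat (Real.pi / 4)) 1 0 : ℂ) * Complex.I + (rotMat (Real.pi / 4)) 1 1) ^ 2
      = Complex.I := by
    simp only [rotMat, Matrix.SpecialLinearGroup.coe_mk, Matrix.of_apply, Matrix.cons_val,
      Real.cos_pi_div_four, Real.sin_pi_div_four]
    push_cast
    linear_combination (1 / 4 * (1 + Complex.I ^ 2 + 2 * Complex.I)) * hs + 1 / 2 * Complex.I_sq
  have hI : rotMat (Real.pi / 4) • UpperHalfPlane.I = UpperHalfPlane.I := by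
    apply UpperHalfPlane.ext
    have h0 : ((rotMat (Real.pi / 4)) 1 0 : ℂ) * Complex.I + (rotMat (Real.pi / 4)) 1 1 ≠ 0 := by
      intro h
      rw [h] at hr
      exact Complex.I_ne_zero (by rw [← hr]; simp)
    rw [coe_specialLinearGroup_apply]
    simp only [Algebra.algebraMap_self, RingHom.id_apply, coe_I]
    rw [div_eq_iff h0]
    simp only [rotMat, Matrix.SpecialLinearGroup.coe_mk, Matrix.of_apply, Matrix.cons_val]
    push_cast
    linear_combination (-Complex.sin (Real.pi / 4)) * Complex.I_sq
  have hR : ∀ z, (quarterTurn p v).1 z =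
      frame p v • (rotMat (Real.pi / 4) • ((frame p v)⁻¹ • z)) := fun z => by
    change (frame p v * rotMat (Real.pi / 4) * (frame p v)⁻¹) • z = _
    rw [mul_smul, mul_smul]
  constructor
  · rw [hR]
    nth_rewrite 3 [← frame_smul_I p v]
    rw [inv_smul_smul, hI, frame_smul_I]
  · have h1 := hasDerivAt_smul (rotMat (Real.pi / 4)) _ _ diagMat_zero_smul diagMat_hasDerivAt
    rw [hr, div_self Complex.I_ne_zero] at h1
    have h2 := hasDerivAt_smul (frame p v) _ _ (by rw [diagMat_zero_smul, hI]) h1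
    rw [frame_denom_sq] at h2
    simp only [hR, geodesic, inv_smul_smul]
    convert h2 using 1
    rw [one_div_div, Complex.div_I]
    ring

end HypTurtle

/-!
The altitude from the apex `s` cuts `T_n` into two mirror triangles with angles `π / 4`, `π / 2`,
`π / n`. In the hyperboloid model the three walls of such a half become linear forms on Minkowski
space with Gram matrix `cos (π / m i j)`, so Tits' argument, an induction on word length in the
Coxeter group with the exponents `m i j`, shows that the half triangle meets each orbit of the
reflection group once. Minimizing the distance of an orbit to an interior point shows that the
reflected copies cover the plane.

Let `a`, `b`, `c` be the reflections in the side `[p, q]`, the side `[p, s]` and the altitude. Then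
`R = b a` and `A_r R² = a c`, so the group generated by `R` and `A_r` consists of the products of
an even number of reflections, and `T_n`, the union of the half triangle and its mirror image under
`c`, is a fundamental domain for it. Evaluating the forms at the vertices identifies
`r_n` as the distance for which the angle at `s` is `2 π / n`.
-/

namespace HypTurtle

open UpperHalfPlane

section CoxeterWords

open CoxeterSystem

variable {ι W : Type*} [Group W] {M : CoxeterMatrix ι} (cs : CoxeterSystem M W)

theorem prod_map_alternatingWord_two_mul {G : Type*} [Monoid G] (f : ι → G) (i j : ι) (k : ℕ) :
    ((alternatingWord i j (2 * k)).map f).prod = (f i * f j) ^ k := by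
  induction k with
  | zero => simp [alternatingWord]
  | succ k ih =>
    rw [mul_add_one, alternatingWord_succ, alternatingWord_succ, pow_succ, ← ih]
    simp

theorem isRightDescent_mul_wordProd_braidWord {v : W} {i j : ι} (hM : M i j ≠ 0)
    (h : cs.length (v * cs.wordProd (braidWord M i j)) = cs.length v + M i j) :
    cs.IsRightDescent (v * cs.wordProd (braidWord M i j)) i := by
  obtain ⟨k, hk⟩ := Nat.exists_eq_add_one_of_ne_zero hM
  have hlast : cs.wordProd (braidWord M i j) =
      cs.wordProd (alternatingWord i j k) * cs.simple i := by
    rw [← cs.wordProd_braidWord_eq, braidWord, M.symmetric, hk, alternatingWord_succ,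
      cs.wordProd_concat]
  have hle : cs.length (v * cs.wordProd (alternatingWord i j k)) ≤ cs.length v + k :=
    (cs.length_mul_le _ _).trans (by simpa using cs.length_wordProd_le (alternatingWord i j k))
  rw [IsRightDescent, h, hk, hlast, mul_assoc, cs.simple_mul_simple_cancel_right]
  exact hle.trans_lt (by lia)

theorem not_isRightDescent_of_length_mul_wordProd_cons {v : W} {i : ι} {ω : List ι}
    (h : cs.length (v * cs.wordProd (i :: ω)) = cs.length v + (ω.length + 1)) :
    ¬cs.IsRightDescent v i := fun hv => by
  have hle := cs.length_mul_le (v * cs.simple i) (cs.wordProd ω)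
  have hω := cs.length_wordProd_le ω
  rw [cs.isRightDescent_iff] at hv
  rw [cs.wordProd_cons, ← mul_assoc] at h
  lia

/-- In the proof `k` is the first number such that `w` has no reduced factorization ending with the
alternating word of length `k + 1`. -/
theorem exists_eq_mul_wordProd_alternatingWord {w : W} {i j : ι} (hM : M i j ≠ 0)
    (hw : ¬cs.IsRightDescent w i) :
    ∃ (v : W) (k : ℕ), w = v * cs.wordProd (alternatingWord i j k) ∧
      cs.length w = cs.length v + k ∧ k < M i j ∧
      ¬cs.IsRightDescent v i ∧ ¬cs.IsRightDescent v j := by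
  classical
  let Factors (k : ℕ) : Prop := ∃ v, w = v * cs.wordProd (alternatingWord i j k) ∧
    cs.length w = cs.length v + k
  have hbraid : ¬Factors (M i j) := by
    rintro ⟨v, rfl, hlen⟩
    exact hw (isRightDescent_mul_wordProd_braidWord cs hM hlen)
  have hexists : ∃ k, ¬Factors k := ⟨_, hbraid⟩
  have hzero : Factors 0 := ⟨w, by simp [alternatingWord], rfl⟩
  obtain ⟨k, hk⟩ := Nat.exists_eq_add_one_of_ne_zero
    (n := Nat.find hexists) fun h => Nat.find_spec hexists (h ▸ hzero)
  have hnext : ¬Factors (k + 1) := hk ▸ Nat.find_spec hexists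
  obtain ⟨v, hv, hlen⟩ : Factors k := not_not.mp (Nat.find_min hexists (by lia))
  have hkM : k < M i j := by
    have := Nat.find_min' hexists hbraid
    lia
  have hleft : ¬cs.IsRightDescent v (if Even k then j else i) := fun hd =>
    hnext ⟨v * cs.simple (if Even k then j else i), by
      rw [alternatingWord_succ', cs.wordProd_cons, ← mul_assoc,
        cs.simple_mul_simple_cancel_right, hv], by
      rw [cs.isRightDescent_iff] at hd; lia⟩
  have hfirst : ¬cs.IsRightDescent v (if Even k then i else j) := by
    rcases k with _ | k
    · simpa [hv, alternatingWord] using hw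
    · rw [hv, alternatingWord_succ'] at hlen
      have hd := not_isRightDescent_of_length_mul_wordProd_cons cs
        (by rwa [length_alternatingWord])
      simpa only [Nat.even_add_one, ite_not] using hd
  refine ⟨v, k, hv, hlen, hkM, ?_⟩
  by_cases hpar : Even k
  · simpa only [hpar, if_true] using And.intro hfirst hleft
  · simpa only [hpar, if_false] using And.intro hleft hfirst

end CoxeterWords

/-- Isometries `s i` of a space, together with functions `F i` on it on which the `s i` act as the
reflections of the geometric representation of the Coxeter matrix `M`. The function `F i` plays the
role of the signed distance to the mirror of `s i`. Since `M i i = 1`, the case `i = j` of `apply`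
says that `s i` changes the sign of `F i`. -/
structure ReflectionSystem {ι E : Type*} [PseudoEMetricSpace E] (M : CoxeterMatrix ι)
    (s : ι → E ≃ᵢ E) (F : ι → E → ℝ) : Prop where
  coxeter_ne_zero : ∀ i j, M i j ≠ 0
  apply : ∀ i j z, F j (s i z) = F j z + 2 * Real.cos (Real.pi / M i j) * F i z
  separating : ∀ z w, (∀ i, F i z = F i w) → z = w

/-- The open chamber of a reflection system. -/
def chamber {ι E : Type*} (F : ι → E → ℝ) : Set E := {z | ∀ i, 0 < F i z}

/-- The closed chamber of a reflection system. -/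
def closedChamber {ι E : Type*} (F : ι → E → ℝ) : Set E := {z | ∀ i, 0 ≤ F i z}

namespace ReflectionSystem

open CoxeterSystem

section Algebra

variable {ι E : Type*} [PseudoEMetricSpace E] {M : CoxeterMatrix ι} {s : ι → E ≃ᵢ E}
  {F : ι → E → ℝ}

theorem apply_self (hR : ReflectionSystem M s F) (i : ι) (z : E) : F i (s i z) = -F i z := by
  have h := hR.apply i i z
  rw [M.diagonal, Nat.cast_one, div_one, Real.cos_pi] at h
  linarith

theorem mul_self (hR : ReflectionSystem M s F) (i : ι) : s i * s i = 1 := by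
  ext z
  refine hR.separating _ _ fun j => ?_
  rw [IsometryEquiv.mul_apply, hR.apply i j (s i z), hR.apply_self, hR.apply i j z,
    IsometryEquiv.coe_one, id]
  ring

theorem inv_eq (hR : ReflectionSystem M s F) (i : ι) : (s i)⁻¹ = s i :=
  inv_eq_of_mul_eq_one_left (hR.mul_self i)

theorem two_le_coxeter (hR : ReflectionSystem M s F) {i j : ι} (hij : i ≠ j) : 2 ≤ M i j := by
  have h0 := hR.coxeter_ne_zero i j
  have h1 := M.off_diagonal i j hij
  lia

theorem sin_pi_div_coxeter_pos (hR : ReflectionSystem M s F) {i j : ι} (hij : i ≠ j) :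
    0 < Real.sin (Real.pi / M i j) := by
  have h2 : (2 : ℝ) ≤ M i j := mod_cast hR.two_le_coxeter hij
  exact Real.sin_pos_of_pos_of_lt_pi (by positivity) (div_lt_self Real.pi_pos (by linarith))

/-- The alternating products of two reflections act on the span of `F i` and `F j` through a
rotation by `2π / M i j`. -/
theorem sin_mul_apply_alternatingWord (hR : ReflectionSystem M s F) (i j : ι) (k : ℕ) (y : E) :
    Real.sin (Real.pi / M i j) * F i (((alternatingWord i j k).map s).prod⁻¹ y) =
      Real.sin ((k + 1) * (Real.pi / M i j)) * F (if Even k then i else j) y +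
        Real.sin (k * (Real.pi / M i j)) * F (if Even k then j else i) y := by
  set θ := Real.pi / M i j with hθ
  have hrec (k : ℕ) : Real.sin ((k + 1 + 1) * θ) =
      2 * Real.cos θ * Real.sin ((k + 1) * θ) - Real.sin (k * θ) := by
    have h1 : ((k : ℝ) + 1 + 1) * θ = (k + 1) * θ + θ := by ring
    have h2 : (k : ℝ) * θ = (k + 1) * θ - θ := by ring
    rw [h1, h2, Real.sin_add, Real.sin_sub]
    ring
  induction k generalizing y with
  | zero => simp [alternatingWord]
  | succ k ih =>
    rw [alternatingWord_succ', List.map_cons, List.prod_cons, mul_inv_rev, hR.inv_eq,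
      IsometryEquiv.mul_apply, ih, Nat.cast_add_one, hrec]
    by_cases hk : Even k
    · simp only [hk, if_true, Nat.even_add_one, not_true, if_false, hR.apply_self,
        hR.apply j i, M.symmetric j i, ← hθ]
      ring
    · simp only [hk, if_false, Nat.even_add_one, not_false_eq_true, if_true, hR.apply_self,
        hR.apply i j, ← hθ]
      ring

theorem apply_pow_inv (hR : ReflectionSystem M s F) {i j : ι} (hij : i ≠ j) (y : E) :
    F i (((s i * s j) ^ M i j)⁻¹ y) = F i y := by
  have hM : (M i j : ℝ) ≠ 0 := Nat.cast_ne_zero.mpr (hR.coxeter_ne_zero i j)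
  have hturn : ((2 * M i j : ℕ) : ℝ) * (Real.pi / M i j) = 2 * Real.pi := by
    push_cast; field_simp
  have h := hR.sin_mul_apply_alternatingWord i j (2 * M i j) y
  rw [prod_map_alternatingWord_two_mul, add_one_mul, hturn, add_comm (2 * Real.pi),
    Real.sin_add_two_pi, Real.sin_two_pi] at h
  simp only [even_two_mul, if_true, zero_mul, add_zero] at h
  exact mul_left_cancel₀ (hR.sin_pi_div_coxeter_pos hij).ne' h

/-- Subtracting from `F l` its projection to the span of `F i` and `F j` leaves a function
invariant under `s i` and `s j`. -/
theorem exists_invariant_combination (hR : ReflectionSystem M s F) {i j : ι} (hij : i ≠ j) (l : ι) :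
    ∃ a b : ℝ, ∀ m ∈ ({i, j} : Set ι), ∀ z,
      F l (s m z) + a * F i (s m z) + b * F j (s m z) = F l z + a * F i z + b * F j z := by
  set A := Real.cos (Real.pi / M i l)
  set B := Real.cos (Real.pi / M j l)
  set c := Real.cos (Real.pi / M i j) with hc
  have hsq : 1 - c ^ 2 ≠ 0 := by
    rw [← Real.sin_sq]
    exact pow_ne_zero 2 (hR.sin_pi_div_coxeter_pos hij).ne'
  refine ⟨(A + B * c) / (1 - c ^ 2), (B + A * c) / (1 - c ^ 2), ?_⟩
  rintro m (rfl | rfl) z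
  · rw [hR.apply_self, hR.apply m l, hR.apply m j, ← hc]
    field_simp
    ring
  · rw [hR.apply_self, hR.apply m l, hR.apply m i, M.symmetric m i, ← hc]
    field_simp
    ring

theorem isLiftable (hR : ReflectionSystem M s F) : M.IsLiftable s := by
  intro i j
  rcases eq_or_ne i j with rfl | hij
  · rw [M.diagonal, pow_one, hR.mul_self]
  rw [← inv_eq_one]
  have hswap : ((s i * s j) ^ M i j)⁻¹ = (s j * s i) ^ M i j := by
    rw [← inv_pow, mul_inv_rev, hR.inv_eq, hR.inv_eq]
  have hi := hR.apply_pow_inv hij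
  have hj (y : E) : F j (((s i * s j) ^ M i j)⁻¹ y) = F j y := by
    have h := hR.apply_pow_inv hij.symm (((s j * s i) ^ M j i) y)
    rw [IsometryEquiv.inv_apply_self] at h
    rw [hswap, M.symmetric i j, h]
  ext y
  refine hR.separating _ _ fun l => ?_
  obtain ⟨a, b, hab⟩ := hR.exists_invariant_combination hij l
  have hpow (k : ℕ) : F l (((s j * s i) ^ k) y) + a * F i (((s j * s i) ^ k) y) +
      b * F j (((s j * s i) ^ k) y) = F l y + a * F i y + b * F j y := by
    induction k with
    | zero => rfl
    | succ k ih =>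
      rw [pow_succ', IsometryEquiv.mul_apply, IsometryEquiv.mul_apply, hab j (by simp),
        hab i (by simp), ih]
  have h := hpow (M i j)
  rw [← hswap, hi, hj] at h
  simpa using h

/-- The action of the Coxeter group of `M` on the space. -/
noncomputable def hom (hR : ReflectionSystem M s F) : M.Group →* (E ≃ᵢ E) :=
  M.toCoxeterSystem.lift ⟨s, hR.isLiftable⟩

theorem hom_simple (hR : ReflectionSystem M s F) (i : ι) :
    hR.hom (M.toCoxeterSystem.simple i) = s i :=
  M.toCoxeterSystem.lift_apply_simple hR.isLiftable i

theorem hom_wordProd (hR : ReflectionSystem M s F) (ω : List ι) :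
    hR.hom (M.toCoxeterSystem.wordProd ω) = (ω.map s).prod := by
  rw [wordProd, map_list_prod, List.map_map]
  exact congrArg List.prod (List.map_congr_left fun i _ => hR.hom_simple i)

/-- Tits' lemma. Split off from `w` a maximal alternating word in `i` and a right descent `j`: the
remaining factor is shorter and makes both `F i` and `F j` positive, and the alternating word
carries `F i` to a combination of these two with nonnegative coefficients, as it is shorter than
`M i j`. -/
theorem pos_of_not_isRightDescent (hR : ReflectionSystem M s F) {w : M.Group} {i : ι}
    (hw : ¬M.toCoxeterSystem.IsRightDescent w i) {z : E} (hz : z ∈ chamber F) :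
    0 < F i (hR.hom w⁻¹ z) := by
  induction hn : M.toCoxeterSystem.length w using Nat.strong_induction_on generalizing w i with
  | _ n ih =>
  rcases eq_or_ne w 1 with rfl | hne
  · simpa using hz i
  obtain ⟨j, hj⟩ := M.toCoxeterSystem.exists_rightDescent_of_ne_one hne
  have hij : i ≠ j := by rintro rfl; exact hw hj
  obtain ⟨v, k, rfl, hlen, hk, hvi, hvj⟩ :=
    exists_eq_mul_wordProd_alternatingWord M.toCoxeterSystem (hR.coxeter_ne_zero i j) hw
  have hk0 : k ≠ 0 := by
    rintro rfl
    exact hvj (by simpa [alternatingWord] using hj)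
  have hFi := ih _ (by lia) hvi rfl
  have hFj := ih _ (by lia) hvj rfl
  set θ := Real.pi / M i j with hθ
  have hMpos : (0 : ℝ) < M i j := by exact_mod_cast Nat.pos_of_ne_zero (hR.coxeter_ne_zero i j)
  have hMθ : M i j * θ = Real.pi := mul_div_cancel₀ _ hMpos.ne'
  have hθpos : 0 < θ := div_pos Real.pi_pos hMpos
  have hk1 : (k : ℝ) + 1 ≤ M i j := by exact_mod_cast hk
  have hsin : 0 < Real.sin (k * θ) :=
    Real.sin_pos_of_pos_of_lt_pi (by positivity) (by nlinarith)
  have hsin' : 0 ≤ Real.sin ((k + 1) * θ) :=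
    Real.sin_nonneg_of_nonneg_of_le_pi (by positivity) (by nlinarith)
  have hrot := hR.sin_mul_apply_alternatingWord i j k (hR.hom v⁻¹ z)
  rw [← hR.hom_wordProd, ← map_inv, ← IsometryEquiv.mul_apply, ← map_mul, ← mul_inv_rev,
    ← hθ] at hrot
  refine (mul_pos_iff_of_pos_left (hR.sin_pi_div_coxeter_pos hij)).mp ?_
  rw [hrot]
  refine add_pos_of_nonneg_of_pos (mul_nonneg hsin' ?_) (mul_pos hsin ?_) <;> split_ifs
  exacts [hFi.le, hFj.le, hFj, hFi]

theorem neg_of_isRightDescent (hR : ReflectionSystem M s F) {w : M.Group} {i : ι}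
    (hw : M.toCoxeterSystem.IsRightDescent w i) {z : E} (hz : z ∈ chamber F) :
    F i (hR.hom w⁻¹ z) < 0 := by
  have h := hR.pos_of_not_isRightDescent
    (M.toCoxeterSystem.isRightDescent_iff_not_isRightDescent_mul.mp hw) hz
  rw [mul_inv_rev, M.toCoxeterSystem.inv_simple, map_mul, hR.hom_simple, IsometryEquiv.mul_apply,
    hR.apply_self] at h
  linarith

theorem eq_one_of_mem_closedChamber (hR : ReflectionSystem M s F) {w : M.Group} {z : E}
    (hz : z ∈ chamber F) (hwz : hR.hom w z ∈ closedChamber F) : w = 1 := by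
  by_contra hne
  obtain ⟨i, hi⟩ := M.toCoxeterSystem.exists_rightDescent_of_ne_one (inv_ne_one.mpr hne)
  have hneg := hR.neg_of_isRightDescent hi hz
  rw [inv_inv] at hneg
  exact hneg.not_ge (hwz i)

end Algebra

section EvenSubgroup

variable {ι E : Type*} [PseudoEMetricSpace E] {M : CoxeterMatrix ι} {s : ι → E ≃ᵢ E} {F : ι → E → ℝ}

/-- The isometries that are products of an even number of the reflections `s i`. -/
noncomputable def evenSubgroup (hR : ReflectionSystem M s F) : Subgroup (E ≃ᵢ E) :=
  M.toCoxeterSystem.lengthParity.ker.map hR.hom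

/-- The closed chamber together with its mirror image in the wall of `a`: a fundamental domain for
the even subgroup, which has index two. -/
def doubledChamber (s : ι → E ≃ᵢ E) (F : ι → E → ℝ) (a : ι) : Set E :=
  closedChamber F ∪ s a ⁻¹' closedChamber F

theorem mul_simple_mem_ker_lengthParity_iff (w : M.Group) (a : ι) :
    w * M.toCoxeterSystem.simple a ∈ M.toCoxeterSystem.lengthParity.ker ↔
      w ∉ M.toCoxeterSystem.lengthParity.ker := by
  rw [MonoidHom.mem_ker, MonoidHom.mem_ker, map_mul, M.toCoxeterSystem.lengthParity_simple]
  generalize M.toCoxeterSystem.lengthParity w = x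
  revert x
  decide

theorem simple_notMem_ker_lengthParity (a : ι) :
    M.toCoxeterSystem.simple a ∉ M.toCoxeterSystem.lengthParity.ker := by
  simpa using (mul_simple_mem_ker_lengthParity_iff (M := M) 1 a).not

theorem exists_mem_evenSubgroup_apply_mem_doubledChamber (hR : ReflectionSystem M s F) (a : ι)
    {z : E} {w : M.Group} (hw : hR.hom w z ∈ closedChamber F) :
    ∃ g ∈ hR.evenSubgroup, g z ∈ doubledChamber s F a := by
  by_cases heven : w ∈ M.toCoxeterSystem.lengthParity.ker
  · exact ⟨_, Subgroup.mem_map_of_mem _ heven, Or.inl hw⟩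
  · have hinv := (mul_simple_mem_ker_lengthParity_iff w⁻¹ a).mpr (by rwa [inv_mem_iff])
    refine ⟨_, Subgroup.mem_map_of_mem _ (inv_mem hinv), Or.inr ?_⟩
    rwa [Set.mem_preimage, mul_inv_rev, inv_inv, M.toCoxeterSystem.inv_simple, map_mul,
      hR.hom_simple, ← IsometryEquiv.mul_apply, ← mul_assoc, hR.mul_self, one_mul]

theorem exists_hom_mem_of_mem_union (hR : ReflectionSystem M s F) (a : ι) {A : Set E} {z : E}
    (hz : z ∈ A ∪ s a ⁻¹' A) :
    ∃ v, (v = 1 ∨ v = M.toCoxeterSystem.simple a) ∧ hR.hom v z ∈ A := by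
  rcases hz with hz | hz
  · exact ⟨1, Or.inl rfl, by simpa using hz⟩
  · exact ⟨_, Or.inr rfl, by rwa [hR.hom_simple]⟩

theorem eq_one_of_apply_mem_doubledChamber (hR : ReflectionSystem M s F) (a : ι)
    {g : E ≃ᵢ E} (hg : g ∈ hR.evenSubgroup) {z : E} (hz : z ∈ chamber F ∪ s a ⁻¹' chamber F)
    (hgz : g z ∈ doubledChamber s F a) : g = 1 := by
  obtain ⟨w, hw, rfl⟩ := hg
  obtain ⟨v, hv, hvz⟩ := hR.exists_hom_mem_of_mem_union a hz
  obtain ⟨u, hu, huz⟩ := hR.exists_hom_mem_of_mem_union a hgz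
  have hone : u * w * v⁻¹ = 1 := hR.eq_one_of_mem_closedChamber hvz (by
    rwa [← IsometryEquiv.mul_apply, ← map_mul, inv_mul_cancel_right, map_mul])
  have hw_eq : w = u⁻¹ * v := by
    rw [eq_inv_mul_iff_mul_eq, ← mul_inv_eq_one, hone]
  have hodd := simple_notMem_ker_lengthParity (M := M) a
  suffices w = 1 by rw [this, map_one]
  rcases hu with rfl | rfl <;> rcases hv with rfl | rfl
  · simpa using hw_eq
  · exact absurd (by simpa [hw_eq] using hw) hodd
  · exact absurd (by simpa [hw_eq] using hw) hodd
  · simpa using hw_eq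

theorem eq_one_of_apply_mem_interior_doubledChamber (hR : ReflectionSystem M s F) (a : ι)
    (hdense : closedChamber F ⊆ closure (chamber F)) {g : E ≃ᵢ E} (hg : g ∈ hR.evenSubgroup)
    {z : E} (hz : z ∈ doubledChamber s F a) (hgz : g z ∈ interior (doubledChamber s F a)) :
    g = 1 := by
  have hclosure : doubledChamber s F a ⊆ closure (chamber F ∪ s a ⁻¹' chamber F) := by
    rw [closure_union]
    refine Set.union_subset_union hdense ?_
    exact (Set.preimage_mono hdense).trans ((s a).toHomeomorph.preimage_closure _).subset
  have hmem : g ⁻¹' interior (doubledChamber s F a) ∈ nhds z :=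
    (isOpen_interior.preimage g.continuous).mem_nhds hgz
  obtain ⟨y, hgy, hy⟩ := mem_closure_iff_nhds.mp (hclosure hz) _ hmem
  exact hR.eq_one_of_apply_mem_doubledChamber a hg hy (interior_subset hgy)

theorem mem_doubledChamber_iff (hR : ReflectionSystem M s F) (a : ι) {z : E} :
    z ∈ doubledChamber s F a ↔
      ∀ i, i ≠ a → 0 ≤ F i z ∧ 0 ≤ F i z + 2 * Real.cos (Real.pi / M a i) * F a z := by
  have hcos {i : ι} (hi : i ≠ a) : 0 ≤ 2 * Real.cos (Real.pi / M a i) := by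
    have htwo : (2 : ℝ) ≤ M a i := by exact_mod_cast hR.two_le_coxeter hi.symm
    have hle : Real.pi / M a i ≤ Real.pi / 2 := by gcongr
    have hpos : 0 ≤ Real.pi / M a i := by positivity
    linarith [Real.cos_nonneg_of_neg_pi_div_two_le_of_le (by linarith [Real.pi_pos]) hle]
  constructor
  · rintro (hz | hz) i hi
    · exact ⟨hz i, add_nonneg (hz i) (mul_nonneg (hcos hi) (hz a))⟩
    · have hza : F a z ≤ 0 := by simpa only [hR.apply_self, neg_nonneg] using hz a
      have hzi : 0 ≤ F i z + 2 * Real.cos (Real.pi / M a i) * F a z := hR.apply a i z ▸ hz i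
      exact ⟨by nlinarith [hcos hi], hzi⟩
  · intro hz
    rcases le_total 0 (F a z) with hza | hza
    · refine Or.inl fun i => ?_
      rcases eq_or_ne i a with rfl | hi
      exacts [hza, (hz i hi).1]
    · refine Or.inr fun i => ?_
      rcases eq_or_ne i a with rfl | hi
      · rwa [hR.apply_self, neg_nonneg]
      · rw [hR.apply]
        exact (hz i hi).2

theorem mul_mem_evenSubgroup (hR : ReflectionSystem M s F) (i j : ι) :
    s i * s j ∈ hR.evenSubgroup := by
  rw [← hR.hom_simple, ← hR.hom_simple, ← map_mul]
  exact Subgroup.mem_map_of_mem _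
    ((mul_simple_mem_ker_lengthParity_iff _ j).mpr (simple_notMem_ker_lengthParity i))

theorem evenSubgroup_le (hR : ReflectionSystem M s F) (a : ι) {H : Subgroup (E ≃ᵢ E)}
    (h : ∀ i, s i * s a ∈ H) : hR.evenSubgroup ≤ H := by
  have hparity (w : M.Group) :
      (w ∈ M.toCoxeterSystem.lengthParity.ker → hR.hom w ∈ H) ∧
        (w ∉ M.toCoxeterSystem.lengthParity.ker → hR.hom w * s a ∈ H) := by
    induction w using M.toCoxeterSystem.simple_induction_right with
    | one => simp
    | mul_simple_right w i ih =>
      rw [map_mul, hR.hom_simple]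
      have hiff := mul_simple_mem_ker_lengthParity_iff w i
      constructor
      · intro heven
        have := H.mul_mem (ih.2 (hiff.mp heven)) (H.inv_mem (h i))
        rwa [mul_inv_rev, hR.inv_eq, hR.inv_eq, mul_assoc, ← mul_assoc (s a), hR.mul_self,
          one_mul] at this
      · intro hodd
        rw [mul_assoc]
        exact H.mul_mem (ih.1 (by rwa [hiff, not_not] at hodd)) (h i)
  rintro _ ⟨w, hw, rfl⟩
  exact (hparity w).1 hw

end EvenSubgroup

section PseudoMetric

variable {ι E : Type*} [Finite ι] [PseudoMetricSpace E] {M : CoxeterMatrix ι} {s : ι → E ≃ᵢ E}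
  {F : ι → E → ℝ}

theorem exists_forall_dist_hom_lt_imp_eq_one (hR : ReflectionSystem M s F)
    (hF : ∀ i, Continuous (F i)) {x : E} (hx : x ∈ chamber F) :
    ∃ ε > 0, ∀ w : M.Group, dist (hR.hom w x) x < ε → w = 1 := by
  have hopen : IsOpen (chamber F) := by
    simpa only [chamber, Set.ofPred_forall] using
      isOpen_iInter_of_finite fun i => isOpen_lt continuous_const (hF i)
  obtain ⟨ε, hε, hball⟩ := Metric.isOpen_iff.mp hopen x hx
  exact ⟨ε, hε, fun w hw => hR.eq_one_of_mem_closedChamber hx fun i => (hball hw i).le⟩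

theorem exists_forall_dist_lt_imp_eq_one (hR : ReflectionSystem M s F)
    (hF : ∀ i, Continuous (F i)) {x : E} (hx : x ∈ chamber F) :
    ∃ ε > 0, ∀ g ∈ hR.evenSubgroup, dist (g x) x < ε → g = 1 := by
  obtain ⟨ε, hε, hsep⟩ := hR.exists_forall_dist_hom_lt_imp_eq_one hF hx
  refine ⟨ε, hε, ?_⟩
  rintro _ ⟨w, -, rfl⟩ hw
  rw [hsep w hw, map_one]

end PseudoMetric

section Proper

variable {ι E : Type*} [Finite ι] [MetricSpace E] [ProperSpace E] {M : CoxeterMatrix ι}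
  {s : ι → E ≃ᵢ E} {F : ι → E → ℝ}

theorem finite_setOf_dist_hom_le (hR : ReflectionSystem M s F)
    (hF : ∀ i, Continuous (F i)) {x : E} (hx : x ∈ chamber F) (z : E) (R : ℝ) :
    {w | dist (hR.hom w z) x ≤ R}.Finite := by
  obtain ⟨ε, hε, hsep⟩ := hR.exists_forall_dist_hom_lt_imp_eq_one hF hx
  let _ : TopologicalSpace M.Group := ⊥
  have : DiscreteTopology M.Group := ⟨rfl⟩
  have horbit : Topology.IsClosedEmbedding fun w => hR.hom w x := by
    refine Metric.isClosedEmbedding_of_pairwise_le_dist hε fun v w hvw => ?_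
    by_contra! hlt
    refine hvw (inv_mul_eq_one.mp (hsep (v⁻¹ * w) ?_))
    rwa [map_mul, IsometryEquiv.mul_apply, ← (hR.hom v).dist_eq, map_inv,
      IsometryEquiv.apply_inv_self, dist_comm]
  have hfin := isCompact_iff_finite.mp
    (horbit.isCompact_preimage (isCompact_closedBall x (dist x z + R)))
  refine hfin.subset fun w hw => Metric.mem_closedBall.mpr ?_
  calc dist (hR.hom w x) x ≤ dist (hR.hom w x) (hR.hom w z) + dist (hR.hom w z) x :=
        dist_triangle _ _ _
    _ ≤ dist x z + R := by rw [(hR.hom w).dist_eq]; exact add_le_add_right hw _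

/-- A point of the orbit of `z` nearest to the chamber point `x` lies in the closed chamber, as
otherwise some `s i` would bring it nearer. -/
theorem exists_hom_mem_closedChamber (hR : ReflectionSystem M s F)
    (hF : ∀ i, Continuous (F i)) {x : E} (hx : x ∈ chamber F)
    (hdist : ∀ i z, F i z < 0 → dist (s i z) x < dist z x) (z : E) :
    ∃ w, hR.hom w z ∈ closedChamber F := by
  obtain ⟨w, hw, hmin⟩ := Set.exists_min_image _ (fun w => dist (hR.hom w z) x)
    (hR.finite_setOf_dist_hom_le hF hx z (dist z x)) ⟨1, by simp⟩
  refine ⟨w, fun i => ?_⟩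
  by_contra! hneg
  have hlt := hdist i _ hneg
  have hsimple : hR.hom (M.toCoxeterSystem.simple i * w) z = s i (hR.hom w z) := by
    rw [map_mul, hR.hom_simple, IsometryEquiv.mul_apply]
  have hle := hmin (M.toCoxeterSystem.simple i * w) (by
    rw [Set.mem_ofPred_eq, hsimple]; exact hlt.le.trans hw)
  rw [hsimple] at hle
  exact hle.not_gt hlt

end Proper


end ReflectionSystem

section Hyperboloid

/-- The Lorentz form of signature `(1, 2)` on `ℝ³`. -/
noncomputable def lorentz : LinearMap.BilinForm ℝ (Fin 3 → ℝ) :=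
  LinearMap.mk₂ ℝ (fun u w => u 0 * w 0 - u 1 * w 1 - u 2 * w 2)
    (fun _ _ _ => by simp only [Pi.add_apply]; ring)
    (fun _ _ _ => by simp only [Pi.smul_apply, smul_eq_mul]; ring)
    (fun _ _ _ => by simp only [Pi.add_apply]; ring)
    (fun _ _ _ => by simp only [Pi.smul_apply, smul_eq_mul]; ring)

theorem lorentz_apply (u w : Fin 3 → ℝ) : lorentz u w = u 0 * w 0 - u 1 * w 1 - u 2 * w 2 := rfl

theorem lorentz_comm (u w : Fin 3 → ℝ) : lorentz u w = lorentz w u := by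
  rw [lorentz_apply, lorentz_apply]
  ring

/-- The isometry of the upper half-plane with the upper sheet of the hyperboloid
`lorentz u u = 1`. -/
noncomputable def hyp (z : ℍ) : Fin 3 → ℝ :=
  ![(z.re ^ 2 + z.im ^ 2 + 1) / (2 * z.im), (z.re ^ 2 + z.im ^ 2 - 1) / (2 * z.im), z.re / z.im]

theorem hyp_apply_zero (z : ℍ) : hyp z 0 = (z.re ^ 2 + z.im ^ 2 + 1) / (2 * z.im) := rfl

theorem hyp_apply_one (z : ℍ) : hyp z 1 = (z.re ^ 2 + z.im ^ 2 - 1) / (2 * z.im) := rfl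

theorem hyp_apply_two (z : ℍ) : hyp z 2 = z.re / z.im := rfl

theorem hyp_apply_zero_pos (z : ℍ) : 0 < hyp z 0 := by
  have := z.im_pos
  rw [hyp_apply_zero]
  positivity

theorem hyp_I : hyp UpperHalfPlane.I = ![1, 0, 0] := by
  simp [hyp]

theorem cosh_dist_eq_lorentz (z w : ℍ) : Real.cosh (dist z w) = lorentz (hyp z) (hyp w) := by
  have hz := z.im_pos.ne'
  have hw := w.im_pos.ne'
  rw [UpperHalfPlane.cosh_dist, Complex.dist_eq, ← Complex.normSq_eq_norm_sq,
    lorentz_apply]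
  simp only [hyp_apply_zero, hyp_apply_one, hyp_apply_two, Complex.normSq_apply, Complex.sub_re,
    Complex.sub_im, coe_re, coe_im]
  field_simp
  ring

theorem lorentz_hyp_self (z : ℍ) : lorentz (hyp z) (hyp z) = 1 := by
  rw [← cosh_dist_eq_lorentz, dist_self, Real.cosh_zero]

theorem lorentz_hyp_pos (z w : ℍ) : 0 < lorentz (hyp z) (hyp w) := by
  rw [← cosh_dist_eq_lorentz]
  exact Real.cosh_pos _

theorem dist_lt_dist_iff_lorentz {z w z' w' : ℍ} :
    dist z w < dist z' w' ↔ lorentz (hyp z) (hyp w) < lorentz (hyp z') (hyp w') := by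
  rw [← cosh_dist_eq_lorentz, ← cosh_dist_eq_lorentz, Real.cosh_lt_cosh,
    abs_of_nonneg dist_nonneg, abs_of_nonneg dist_nonneg]

theorem dist_eq_dist_iff_lorentz {z w z' w' : ℍ} :
    dist z w = dist z' w' ↔ lorentz (hyp z) (hyp w) = lorentz (hyp z') (hyp w') := by
  simp only [le_antisymm_iff, ← not_lt, dist_lt_dist_iff_lorentz]

theorem hyp_injective : Function.Injective hyp := fun z w h => by
  rw [← dist_eq_zero, ← dist_self z, dist_eq_dist_iff_lorentz, h]

theorem continuous_hyp : Continuous hyp := by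
  have him (z : ℍ) : 2 * z.im ≠ 0 := by have := z.im_pos; positivity
  refine continuous_pi fun i => ?_
  fin_cases i
  · exact Continuous.div₀ (by fun_prop) (by fun_prop) him
  · exact Continuous.div₀ (by fun_prop) (by fun_prop) him
  · exact Continuous.div₀ (by fun_prop) (by fun_prop) fun z => z.im_pos.ne'

theorem hyp_eq_of_lightcone {z : ℍ} {u : Fin 3 → ℝ} (hu : lorentz u u = 1)
    (him : u 0 - u 1 = 1 / z.im) (hre : u 2 = z.re / z.im) : hyp z = u := by
  have hz := z.im_pos.ne'
  have hsum : u 0 + u 1 = (z.re ^ 2 + z.im ^ 2) / z.im := by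
    have hprod : (u 0 + u 1) * (1 / z.im) = 1 + (z.re / z.im) ^ 2 := by
      rw [lorentz_apply] at hu
      rw [← him, ← hre]
      linear_combination hu
    field_simp at hprod ⊢
    linear_combination hprod
  ext i
  fin_cases i
  · rw [Fin.zero_eta, hyp_apply_zero, show u 0 = ((u 0 + u 1) + (u 0 - u 1)) / 2 by ring, hsum, him]
    field_simp
  · rw [Fin.mk_one, hyp_apply_one, show u 1 = ((u 0 + u 1) - (u 0 - u 1)) / 2 by ring, hsum, him]
    field_simp
  · exact hre.symm

theorem exists_hyp_eq {u : Fin 3 → ℝ} (h0 : 0 < u 0) (hu : lorentz u u = 1) : ∃ z, hyp z = u := by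
  have hC : 0 < u 0 - u 1 := by
    rw [lorentz_apply] at hu
    nlinarith [sq_nonneg (u 2), sq_nonneg (u 0 + u 1)]
  refine ⟨⟨⟨u 2 / (u 0 - u 1), 1 / (u 0 - u 1)⟩, one_div_pos.mpr hC⟩, hyp_eq_of_lightcone hu ?_ ?_⟩
  · exact (one_div_one_div _).symm
  · change u 2 = u 2 / (u 0 - u 1) / (1 / (u 0 - u 1))
    field_simp

/-- By Cauchy-Schwarz, the orthogonal complement of a timelike vector is negative definite. -/
theorem eq_zero_of_lorentz_hyp_eq_zero {u : Fin 3 → ℝ} {z : ℍ} (huz : lorentz u (hyp z) = 0)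
    (hu : 0 ≤ lorentz u u) : u = 0 := by
  have hz := lorentz_hyp_self z
  rw [lorentz_apply] at huz hu hz
  have hcauchy : (u 1 * hyp z 1 + u 2 * hyp z 2) ^ 2 ≤
      (u 1 ^ 2 + u 2 ^ 2) * (hyp z 1 ^ 2 + hyp z 2 ^ 2) := by
    linarith [sq_nonneg (u 1 * hyp z 2 - u 2 * hyp z 1)]
  have hspace : u 1 ^ 2 + u 2 ^ 2 ≤ 0 := by
    have h1 : u 1 * hyp z 1 + u 2 * hyp z 2 = u 0 * hyp z 0 := by linarith
    have h2 : hyp z 1 ^ 2 + hyp z 2 ^ 2 = hyp z 0 ^ 2 - 1 := by linarith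
    rw [h1, h2] at hcauchy
    nlinarith [mul_nonneg hu (sq_nonneg (hyp z 0))]
  have h1 : u 1 = 0 := by nlinarith
  have h2 : u 2 = 0 := by nlinarith
  have h0 : u 0 = 0 := by
    rw [h1, h2] at huz
    simpa [(hyp_apply_zero_pos z).ne'] using huz
  ext i
  fin_cases i
  exacts [h0, h1, h2]

theorem apply_zero_pos_of_lorentz_hyp_pos {u : Fin 3 → ℝ} {z : ℍ} (hu : lorentz u u = 1)
    (huz : 0 < lorentz u (hyp z)) : 0 < u 0 := by
  have hz := lorentz_hyp_self z
  have hz0 := hyp_apply_zero_pos z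
  rw [lorentz_apply] at hu huz hz
  by_contra! hu0
  have hcauchy : (u 1 * hyp z 1 + u 2 * hyp z 2) ^ 2 ≤ (u 0 ^ 2 - 1) * (hyp z 0 ^ 2 - 1) := by
    have h1 : u 0 ^ 2 - 1 = u 1 ^ 2 + u 2 ^ 2 := by linarith
    have h2 : hyp z 0 ^ 2 - 1 = hyp z 1 ^ 2 + hyp z 2 ^ 2 := by linarith
    rw [h1, h2]
    linarith [sq_nonneg (u 1 * hyp z 2 - u 2 * hyp z 1)]
  have hneg : u 0 * hyp z 0 ≤ 0 := mul_nonpos_of_nonpos_of_nonneg hu0 hz0.le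
  have hlt : (u 0 * hyp z 0) ^ 2 < (u 1 * hyp z 1 + u 2 * hyp z 2) ^ 2 := by nlinarith
  nlinarith [sq_nonneg (u 1), sq_nonneg (u 2), sq_nonneg (hyp z 1), sq_nonneg (hyp z 2)]

theorem lorentz_smul_add_smul_self (a b : ℍ) (l k : ℝ) :
    lorentz (l • hyp a + k • hyp b) (l • hyp a + k • hyp b) =
      l ^ 2 + k ^ 2 + 2 * l * k * lorentz (hyp a) (hyp b) := by
  simp only [map_add, map_smul, LinearMap.add_apply, LinearMap.smul_apply, smul_eq_mul,
    lorentz_hyp_self, lorentz_comm (hyp b) (hyp a)]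
  ring

theorem exists_smul_hyp_eq_add (a b : ℍ) {l k : ℝ} (hl : 0 ≤ l) (hk : 0 ≤ k) (hlk : 0 < l + k) :
    ∃ N : ℝ, 0 < N ∧ ∃ z, N • hyp z = l • hyp a + k • hyp b := by
  set u := l • hyp a + k • hyp b with hu
  have h0 : 0 < u 0 := by
    have ha := hyp_apply_zero_pos a
    have hb := hyp_apply_zero_pos b
    rw [hu]
    simp only [Pi.add_apply, Pi.smul_apply, smul_eq_mul]
    rcases hl.eq_or_lt with rfl | hl <;> nlinarith
  have huu : 0 < lorentz u u := by
    have hab := lorentz_hyp_pos a b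
    rw [hu, lorentz_smul_add_smul_self]
    nlinarith [mul_nonneg (mul_nonneg hl hk) hab.le, sq_nonneg (l - k), mul_pos hlk hlk]
  have hsqrt := Real.sqrt_pos.mpr huu
  obtain ⟨z, hz⟩ := exists_hyp_eq (u := (√(lorentz u u))⁻¹ • u)
    (mul_pos (inv_pos.mpr hsqrt) h0) (by
      rw [map_smul, LinearMap.map_smul₂, smul_eq_mul, smul_eq_mul, ← mul_assoc,
        ← mul_inv, Real.mul_self_sqrt huu.le, inv_mul_cancel₀ huu.ne'])
  exact ⟨_, hsqrt, z, by rw [hz, smul_inv_smul₀ hsqrt.ne']⟩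

end Hyperboloid

section Triangle

theorem hyp_eq_of_dist_add_dist {a b z : ℍ} (h : dist a z + dist z b = dist a b) (hab : a ≠ b) :
    hyp z = (Real.sinh (dist z b) / Real.sinh (dist a b)) • hyp a +
      (Real.sinh (dist a z) / Real.sinh (dist a b)) • hyp b := by
  have hS : Real.sinh (dist a b) ≠ 0 := (Real.sinh_pos_iff.mpr (dist_pos.mpr hab)).ne'
  have h1 := Real.sinh_sub (dist a b) (dist a z)
  have h2 := Real.sinh_sub (dist a b) (dist z b)
  have h3 := Real.sinh_add (dist a z) (dist z b)
  rw [show dist a b - dist a z = dist z b by linarith] at h1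
  rw [show dist a b - dist z b = dist a z by linarith] at h2
  rw [h] at h3
  set l := Real.sinh (dist z b) / Real.sinh (dist a b) with hl
  set k := Real.sinh (dist a z) / Real.sinh (dist a b) with hk
  set u := hyp z - (l • hyp a + k • hyp b) with hu
  have hexpand (w : Fin 3 → ℝ) :
      lorentz u w = lorentz (hyp z) w - (l * lorentz (hyp a) w + k * lorentz (hyp b) w) := by
    simp only [hu, map_sub, map_add, map_smul, LinearMap.sub_apply, LinearMap.add_apply,
      LinearMap.smul_apply, smul_eq_mul]
  have hua : lorentz u (hyp a) = 0 := by
    rw [hexpand, lorentz_comm (hyp z), lorentz_comm (hyp b), lorentz_hyp_self,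
      ← cosh_dist_eq_lorentz, ← cosh_dist_eq_lorentz, hl, hk]
    field_simp
    linarith
  have hub : lorentz u (hyp b) = 0 := by
    rw [hexpand, lorentz_hyp_self, ← cosh_dist_eq_lorentz, ← cosh_dist_eq_lorentz, hl, hk]
    field_simp
    linarith
  have huu : lorentz u u = 0 := by
    have hright : lorentz u u = lorentz u (hyp z) := by
      conv_lhs => rw [lorentz_comm, hexpand]
      rw [lorentz_comm _ u, lorentz_comm _ u, lorentz_comm _ u, hua, hub]
      ring
    rw [hright, hexpand, lorentz_hyp_self, lorentz_comm (hyp b), ← cosh_dist_eq_lorentz,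
      ← cosh_dist_eq_lorentz, hl, hk]
    field_simp
    linarith
  exact sub_eq_zero.mp (eq_zero_of_lorentz_hyp_eq_zero hua huu.ge)

theorem dist_add_dist_of_hyp_eq {a b z : ℍ} {l k : ℝ} (hl : 0 ≤ l) (hk : 0 ≤ k)
    (hz : hyp z = l • hyp a + k • hyp b) : dist a z + dist z b = dist a b := by
  have hunit := lorentz_hyp_self z
  rw [hz, lorentz_smul_add_smul_self, ← cosh_dist_eq_lorentz] at hunit
  have hcosh_a : Real.cosh (dist a z) = l + k * Real.cosh (dist a b) := by
    rw [cosh_dist_eq_lorentz, hz, map_add, map_smul, map_smul, lorentz_hyp_self,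
      cosh_dist_eq_lorentz, smul_eq_mul, smul_eq_mul, mul_one]
  have hcosh_b : Real.cosh (dist z b) = l * Real.cosh (dist a b) + k := by
    rw [dist_comm, cosh_dist_eq_lorentz, hz, map_add, map_smul, map_smul, lorentz_hyp_self,
      ← cosh_dist_eq_lorentz, dist_comm, smul_eq_mul, smul_eq_mul, mul_one]
  have hsinh_nonneg (x y : ℍ) : 0 ≤ Real.sinh (dist x y) := Real.sinh_nonneg_iff.mpr dist_nonneg
  have hsinh_a : Real.sinh (dist a z) = k * Real.sinh (dist a b) := by
    rw [← sq_eq_sq₀ (hsinh_nonneg _ _) (mul_nonneg hk (hsinh_nonneg _ _)), mul_pow, Real.sinh_sq,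
      Real.sinh_sq, hcosh_a]
    linear_combination hunit
  have hsinh_b : Real.sinh (dist z b) = l * Real.sinh (dist a b) := by
    rw [← sq_eq_sq₀ (hsinh_nonneg _ _) (mul_nonneg hl (hsinh_nonneg _ _)), mul_pow, Real.sinh_sq,
      Real.sinh_sq, hcosh_b]
    linear_combination hunit
  refine Real.cosh_strictMonoOn.injOn (add_nonneg dist_nonneg dist_nonneg) dist_nonneg ?_
  rw [Real.cosh_add, hcosh_a, hcosh_b, hsinh_a, hsinh_b]
  linear_combination Real.cosh (dist a b) * hunit - l * k * Real.cosh_sq (dist a b)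

theorem mem_segment_iff_hyp {a b z : ℍ} :
    z ∈ segment a b ↔ ∃ l k : ℝ, 0 ≤ l ∧ 0 ≤ k ∧ hyp z = l • hyp a + k • hyp b := by
  refine ⟨fun h => ?_, fun ⟨l, k, hl, hk, hz⟩ => dist_add_dist_of_hyp_eq hl hk hz⟩
  rcases eq_or_ne a b with rfl | hab
  · have hza : a = z := dist_le_zero.mp (by
      have := h.trans (dist_self a)
      rw [dist_comm z a] at this
      linarith)
    exact ⟨1, 0, zero_le_one, le_rfl, by simp [hza]⟩
  · exact ⟨_, _, by positivity, by positivity, hyp_eq_of_dist_add_dist h hab⟩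

theorem left_mem_segment (a b : ℍ) : a ∈ segment a b := by
  simp [segment]

theorem mem_triangle_iff_hyp {a b c z : ℍ} :
    z ∈ triangle a b c ↔ ∃ l m k : ℝ, 0 ≤ l ∧ 0 ≤ m ∧ 0 ≤ k ∧
      hyp z = l • hyp a + m • hyp b + k • hyp c := by
  constructor
  · rintro ⟨x, hx, hz⟩
    obtain ⟨m, k, hm, hk, hx⟩ := mem_segment_iff_hyp.mp hx
    obtain ⟨l, t, hl, ht, hz⟩ := mem_segment_iff_hyp.mp hz
    refine ⟨l, t * m, t * k, hl, mul_nonneg ht hm, mul_nonneg ht hk, ?_⟩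
    rw [hz, hx, smul_add, smul_smul, smul_smul, add_assoc]
  · rintro ⟨l, m, k, hl, hm, hk, hz⟩
    rcases (add_nonneg hm hk).eq_or_lt with h0 | hpos
    · obtain ⟨rfl, rfl⟩ := (add_eq_zero_iff_of_nonneg hm hk).mp h0.symm
      exact ⟨b, left_mem_segment b c, mem_segment_iff_hyp.mpr ⟨l, 0, hl, le_rfl, by simpa using hz⟩⟩
    obtain ⟨N, hN, x, hx⟩ := exists_smul_hyp_eq_add b c hm hk hpos
    refine ⟨x, mem_segment_iff_hyp.mpr ⟨N⁻¹ * m, N⁻¹ * k, by positivity, by positivity, ?_⟩,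
      mem_segment_iff_hyp.mpr ⟨l, N, hl, hN.le, by rw [hz, hx, add_assoc]⟩⟩
    rw [mul_smul, mul_smul, ← smul_add, ← hx, inv_smul_smul₀ hN.ne']

/-- `f i` is the coordinate dual to the `i`-th vertex, up to a positive factor. -/
theorem mem_triangle_iff_forall_nonneg {v : Fin 3 → ℍ} {f : Fin 3 → Module.Dual ℝ (Fin 3 → ℝ)}
    (hpos : ∀ i, 0 < f i (hyp (v i))) (hzero : ∀ i j, i ≠ j → f i (hyp (v j)) = 0) {z : ℍ} :
    z ∈ triangle (v 0) (v 1) (v 2) ↔ ∀ i, 0 ≤ f i (hyp z) := by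
  have happly (c : Fin 3 → ℝ) (i : Fin 3) :
      f i (∑ j, c j • hyp (v j)) = c i * f i (hyp (v i)) := by
    rw [map_sum, Finset.sum_eq_single i _ (by simp), map_smul, smul_eq_mul]
    intro j _ hji
    rw [map_smul, hzero i j hji.symm, smul_zero]
  have hinj : Function.Injective (LinearMap.pi f) := by
    rw [LinearMap.injective_iff_surjective]
    refine fun c => ⟨∑ j, (c j / f j (hyp (v j))) • hyp (v j), funext fun i => ?_⟩
    rw [LinearMap.pi_apply, happly, div_mul_cancel₀ _ (hpos i).ne']
  rw [mem_triangle_iff_hyp]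
  constructor
  · rintro ⟨l, m, k, hl, hm, hk, hz⟩ i
    have hsum : hyp z = ∑ j, ![l, m, k] j • hyp (v j) := by rw [hz, Fin.sum_univ_three]; rfl
    rw [hsum, happly]
    refine mul_nonneg ?_ (hpos i).le
    fin_cases i
    exacts [hl, hm, hk]
  · intro hz
    have hcoord (i : Fin 3) : 0 ≤ f i (hyp z) / f i (hyp (v i)) := div_nonneg (hz i) (hpos i).le
    refine ⟨_, _, _, hcoord 0, hcoord 1, hcoord 2, ?_⟩
    rw [← Fin.sum_univ_three fun j => (f j (hyp z) / f j (hyp (v j))) • hyp (v j)]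
    refine hinj (funext fun i => ?_)
    rw [LinearMap.pi_apply, LinearMap.pi_apply, happly, div_mul_cancel₀ _ (hpos i).ne']

end Triangle

section HyperbolicReflection

theorem lorentz_add_smul_add_smul {e : Fin 3 → ℝ} (he : lorentz e e = -1) (u w : Fin 3 → ℝ) :
    lorentz (u + (2 * lorentz e u) • e) (w + (2 * lorentz e w) • e) = lorentz u w := by
  simp only [map_add, map_smul, LinearMap.add_apply, LinearMap.smul_apply, smul_eq_mul, he,
    lorentz_comm u e]
  ring

theorem exists_hyp_eq_add_smul {e : Fin 3 → ℝ} (he : lorentz e e = -1) (z : ℍ) :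
    ∃ w, hyp w = hyp z + (2 * lorentz e (hyp z)) • e := by
  have hunit : lorentz (hyp z + (2 * lorentz e (hyp z)) • e)
      (hyp z + (2 * lorentz e (hyp z)) • e) = 1 := by
    rw [lorentz_add_smul_add_smul he, lorentz_hyp_self]
  refine exists_hyp_eq (apply_zero_pos_of_lorentz_hyp_pos (z := z) hunit ?_) hunit
  rw [map_add, map_smul, LinearMap.add_apply, LinearMap.smul_apply, lorentz_hyp_self, smul_eq_mul]
  nlinarith [sq_nonneg (lorentz e (hyp z))]

/-- The reflection of `ℍ` in the geodesic `lorentz e (hyp z) = 0`. -/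
noncomputable def hypReflection (e : Fin 3 → ℝ) (he : lorentz e e = -1) : ℍ ≃ᵢ ℍ :=
  have hspec (z : ℍ) := (exists_hyp_eq_add_smul he z).choose_spec
  IsometryEquiv.mk' (fun z => (exists_hyp_eq_add_smul he z).choose)
    (fun z => (exists_hyp_eq_add_smul he z).choose)
    (fun z => hyp_injective (by
      rw [hspec, hspec, map_add, map_smul, he, smul_eq_mul, add_assoc, ← add_smul]
      ring_nf
      rw [zero_smul, add_zero]))
    (Isometry.of_dist_eq fun z w => by
      rw [dist_eq_dist_iff_lorentz, hspec, hspec, lorentz_add_smul_add_smul he])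

theorem hyp_hypReflection {e : Fin 3 → ℝ} (he : lorentz e e = -1) (z : ℍ) :
    hyp (hypReflection e he z) = hyp z + (2 * lorentz e (hyp z)) • e :=
  (exists_hyp_eq_add_smul he z).choose_spec

theorem dist_hypReflection_lt {e : Fin 3 → ℝ} (he : lorentz e e = -1) {x z : ℍ}
    (hx : 0 < lorentz e (hyp x)) (hz : lorentz e (hyp z) < 0) :
    dist (hypReflection e he z) x < dist z x := by
  rw [dist_lt_dist_iff_lorentz, hyp_hypReflection, map_add, map_smul, LinearMap.add_apply,
    LinearMap.smul_apply, smul_eq_mul]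
  nlinarith

theorem reflectionSystem_hypReflection {ι : Type*} {M : CoxeterMatrix ι} (hM : ∀ i j, M i j ≠ 0)
    {e : ι → Fin 3 → ℝ} (he : ∀ i, lorentz (e i) (e i) = -1)
    (hgram : ∀ i j, lorentz (e i) (e j) = Real.cos (Real.pi / M i j))
    (hspan : ∀ u, (∀ i, lorentz (e i) u = 0) → u = 0) :
    ReflectionSystem M (fun i => hypReflection (e i) (he i))
      (fun i z => lorentz (e i) (hyp z)) where
  coxeter_ne_zero := hM
  apply i j z := by
    rw [hyp_hypReflection, map_add, map_smul, smul_eq_mul, hgram, M.symmetric]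
    ring
  separating z w h := hyp_injective (sub_eq_zero.mp (hspan _ fun i => by
    rw [map_sub, h, sub_self]))

/-- The points of the segment from `z` to a point of the chamber approximate `z`. -/
theorem closedChamber_subset_closure_chamber {ι : Type*} {e : ι → Fin 3 → ℝ} {x : ℍ}
    (hx : x ∈ chamber fun i z => lorentz (e i) (hyp z)) :
    closedChamber (fun i z => lorentz (e i) (hyp z)) ⊆
      closure (chamber fun i z => lorentz (e i) (hyp z)) := by
  intro z hz
  refine Metric.mem_closure_iff.mpr fun ε hε => ?_
  have hzx : 1 ≤ lorentz (hyp z) (hyp x) := by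
    rw [← cosh_dist_eq_lorentz]
    exact Real.one_le_cosh _
  have hcosh : 0 < Real.cosh ε - 1 := sub_pos.mpr (Real.one_lt_cosh.mpr hε.ne')
  set k := (Real.cosh ε - 1) / (2 * lorentz (hyp z) (hyp x)) with hk
  have hkpos : 0 < k := by positivity
  have hkmul : k * lorentz (hyp z) (hyp x) = (Real.cosh ε - 1) / 2 := by
    rw [hk]
    field_simp
  obtain ⟨N, hN, y, hy⟩ := exists_smul_hyp_eq_add z x zero_le_one hkpos.le (by linarith)
  rw [one_smul] at hy
  have happly (e : Fin 3 → ℝ) :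
      N * lorentz e (hyp y) = lorentz e (hyp z) + k * lorentz e (hyp x) := by
    rw [← smul_eq_mul, ← map_smul, hy, map_add, map_smul, smul_eq_mul]
  refine ⟨y, fun i => ?_, ?_⟩
  · have : 0 < N * lorentz (e i) (hyp y) := by
      rw [happly]
      exact add_pos_of_nonneg_of_pos (hz i) (mul_pos hkpos (hx i))
    exact pos_of_mul_pos_right this hN.le
  · have hNone : 1 ≤ N := by
      have hself : N * N = 1 + k ^ 2 + 2 * k * lorentz (hyp z) (hyp x) := by
        have := lorentz_smul_add_smul_self z x 1 k
        rw [one_smul, ← hy, map_smul, LinearMap.map_smul₂, lorentz_hyp_self] at this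
        simpa using this
      nlinarith [mul_pos hkpos (zero_lt_one.trans_le hzx)]
    have hcoshy := happly (hyp z)
    rw [lorentz_hyp_self, hkmul, ← cosh_dist_eq_lorentz] at hcoshy
    rw [← abs_of_nonneg (dist_nonneg (x := z)), ← abs_of_pos hε, ← Real.cosh_lt_cosh]
    nlinarith [Real.one_le_cosh (dist z y)]

end HyperbolicReflection

section Moebius

theorem one_div_im_smul (g : Matrix.SpecialLinearGroup (Fin 2) ℝ) (z : ℍ) :
    1 / (g • z).im = ((g 1 0 * z.re + g 1 1) ^ 2 + (g 1 0 * z.im) ^ 2) / z.im := by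
  have hdet : g 0 0 * g 1 1 - g 0 1 * g 1 0 = 1 := by rw [← Matrix.det_fin_two, g.2]
  rw [← coe_im (g • z), coe_specialLinearGroup_apply, Complex.div_im, ← sub_div, one_div_div]
  simp only [Algebra.algebraMap_self, RingHom.id_apply, Complex.normSq_apply, Complex.add_re,
    Complex.add_im, Complex.mul_re, Complex.mul_im, Complex.ofReal_re, Complex.ofReal_im, coe_re,
    coe_im, zero_mul, sub_zero, add_zero]
  congr 1
  · ring
  · linear_combination z.im * hdet

theorem re_smul_div_im_smul (g : Matrix.SpecialLinearGroup (Fin 2) ℝ) (z : ℍ) :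
    (g • z).re / (g • z).im = ((g 0 0 * z.re + g 0 1) * (g 1 0 * z.re + g 1 1) +
      g 0 0 * g 1 0 * z.im ^ 2) / z.im := by
  have him := one_div_im_smul g z
  rw [div_eq_div_iff (g • z).im_pos.ne' z.im_pos.ne', one_mul] at him
  have hz : z.im ≠ 0 := z.im_pos.ne'
  have hD : (g 1 0 * z.re + g 1 1) ^ 2 + (g 1 0 * z.im) ^ 2 ≠ 0 := by
    rintro h
    rw [h, zero_mul] at him
    exact hz him
  rw [div_eq_mul_one_div, one_div_im_smul, ← coe_re (g • z), coe_specialLinearGroup_apply,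
    Complex.div_re, ← add_div, mul_div_assoc', eq_comm]
  congr 1
  simp only [Algebra.algebraMap_self, RingHom.id_apply, Complex.normSq_apply, Complex.add_re,
    Complex.add_im, Complex.mul_re, Complex.mul_im, Complex.ofReal_re, Complex.ofReal_im, coe_re,
    coe_im, zero_mul, sub_zero, add_zero]
  rw [← sq, ← sq, div_mul_cancel₀ _ hD]
  ring

theorem hyp_diagMat_smul (t : ℝ) (z : ℍ) :
    hyp (diagMat t • z) = ![Real.cosh t * hyp z 0 + Real.sinh t * hyp z 1,
      Real.sinh t * hyp z 0 + Real.cosh t * hyp z 1, hyp z 2] := by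
  have hz := z.im_pos.ne'
  have hexp : Real.exp (t / 2) * Real.exp (-(t / 2)) = 1 := by simp [← Real.exp_add]
  have hexp_neg : Real.exp (-t) = Real.exp (-(t / 2)) ^ 2 := by
    rw [← Real.exp_nat_mul]
    congr 1
    push_cast
    ring
  refine hyp_eq_of_lightcone ?_ ?_ ?_
  · rw [← lorentz_hyp_self z]
    simp only [lorentz_apply, Matrix.cons_val]
    linear_combination (hyp z 0 ^ 2 - hyp z 1 ^ 2) * Real.cosh_sq_sub_sinh_sq t
  · rw [one_div_im_smul]
    simp only [diagMat, hyp, Matrix.SpecialLinearGroup.coe_mk, Matrix.of_apply, Matrix.cons_val]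
    rw [zero_mul, zero_add, zero_mul, ← hexp_neg, ← Real.cosh_sub_sinh]
    field_simp
    ring
  · rw [re_smul_div_im_smul]
    simp only [diagMat, hyp, Matrix.SpecialLinearGroup.coe_mk, Matrix.of_apply, Matrix.cons_val]
    congr 1
    linear_combination (-z.re) * hexp

theorem hyp_rotMat_smul (θ : ℝ) (z : ℍ) :
    hyp (rotMat θ • z) = ![hyp z 0, Real.cos (2 * θ) * hyp z 1 - Real.sin (2 * θ) * hyp z 2,
      Real.sin (2 * θ) * hyp z 1 + Real.cos (2 * θ) * hyp z 2] := by
  have hz := z.im_pos.ne'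
  refine hyp_eq_of_lightcone ?_ ?_ ?_
  · rw [← lorentz_hyp_self z]
    simp only [lorentz_apply, Matrix.cons_val]
    linear_combination (-(hyp z 1 ^ 2 + hyp z 2 ^ 2)) * Real.sin_sq_add_cos_sq (2 * θ)
  · rw [one_div_im_smul, Real.sin_two_mul, Real.cos_two_mul]
    simp only [rotMat, hyp, Matrix.SpecialLinearGroup.coe_mk, Matrix.of_apply, Matrix.cons_val]
    field_simp
    linear_combination (-2 * (z.re ^ 2 + z.im ^ 2)) * Real.sin_sq_add_cos_sq θ
  · rw [re_smul_div_im_smul, Real.sin_two_mul, Real.cos_two_mul']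
    simp only [rotMat, hyp, Matrix.SpecialLinearGroup.coe_mk, Matrix.of_apply, Matrix.cons_val]
    field_simp
    ring

theorem hyp_rotMat_smul_diagMat_smul_I (θ t : ℝ) :
    hyp (rotMat θ • diagMat t • UpperHalfPlane.I) =
      ![Real.cosh t, Real.sinh t * Real.cos (2 * θ), Real.sinh t * Real.sin (2 * θ)] := by
  rw [hyp_rotMat_smul, hyp_diagMat_smul, hyp_I]
  simp [mul_comm]

end Moebius

section Trigonometry

theorem UnitTangent.ne_zero {p : ℍ} (v : UnitTangent p) : v.1 ≠ 0 :=
  norm_ne_zero_iff.mp (v.2.trans_ne p.im_pos.ne')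

theorem cpow_one_half_sq (w : ℂ) : (w ^ (1 / 2 : ℂ)) ^ 2 = w := by
  rw [one_div]
  exact Complex.cpow_nat_inv_pow _ two_ne_zero

/-- The sign comes from the choice of square root in `frame`. -/
theorem frame_turnCW (p : ℍ) (v : UnitTangent p) (θ : ℝ) :
    frame p (v.turnCW (2 * θ)) = frame p v * rotMat θ ∨
      frame p (v.turnCW (2 * θ)) = -(frame p v * rotMat θ) := by
  have hv := v.ne_zero
  set u := (Complex.I / v.1) ^ (1 / 2 : ℂ) with hu
  set u' := (Complex.I / (v.turnCW (2 * θ)).1) ^ (1 / 2 : ℂ) with hu'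
  have hsq : u' ^ 2 = (u * Complex.exp (θ * Complex.I)) ^ 2 := by
    rw [mul_pow, hu, hu', cpow_one_half_sq, cpow_one_half_sq, ← Complex.exp_nat_mul]
    change Complex.I / (Complex.exp (-(((2 * θ : ℝ) : ℂ) * Complex.I)) * v.1) = _
    rw [Complex.exp_neg, Complex.ofReal_mul, Complex.ofReal_ofNat, Nat.cast_ofNat, mul_assoc]
    field_simp
  have hexp : Complex.exp (θ * Complex.I) = ⟨Real.cos θ, Real.sin θ⟩ :=
    Complex.ext (Complex.exp_ofReal_mul_I_re θ) (Complex.exp_ofReal_mul_I_im θ)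
  have hframe : (frame p (v.turnCW (2 * θ)) : Matrix (Fin 2) (Fin 2) ℝ) =
      !![((p : ℂ) * u').im, ((p : ℂ) * u').re; u'.im, u'.re] := rfl
  have hprod : (frame p v * rotMat θ : Matrix (Fin 2) (Fin 2) ℝ) =
      !![((p : ℂ) * (u * Complex.exp (θ * Complex.I))).im,
        ((p : ℂ) * (u * Complex.exp (θ * Complex.I))).re;
        (u * Complex.exp (θ * Complex.I)).im, (u * Complex.exp (θ * Complex.I)).re] := by
    rw [hexp]
    change !![((p : ℂ) * u).im, ((p : ℂ) * u).re; u.im, u.re] *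
      !![Real.cos θ, -Real.sin θ; Real.sin θ, Real.cos θ] = _
    rw [Matrix.mul_fin_two]
    simp only [Complex.mul_re, Complex.mul_im]
    ring_nf
  rcases sq_eq_sq_iff_eq_or_eq_neg.mp hsq with h | h
  · refine Or.inl (Subtype.ext ?_)
    rw [Matrix.SpecialLinearGroup.coe_mul, hframe, hprod, h]
  · refine Or.inr (Subtype.ext ?_)
    rw [Matrix.SpecialLinearGroup.coe_neg, Matrix.SpecialLinearGroup.coe_mul, hframe, hprod, h]
    simp

theorem neg_specialLinearGroup_smul (g : Matrix.SpecialLinearGroup (Fin 2) ℝ) (z : ℍ) :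
    (-g) • z = g • z := by
  apply UpperHalfPlane.ext
  rw [coe_specialLinearGroup_apply, coe_specialLinearGroup_apply]
  simp only [Matrix.SpecialLinearGroup.coe_neg, Matrix.neg_apply, map_neg, Complex.ofReal_neg,
    neg_mul, ← neg_add, neg_div_neg_eq]

theorem geodesic_turnCW (p : ℍ) (v : UnitTangent p) (θ t : ℝ) :
    geodesic p (v.turnCW (2 * θ)) t = frame p v • rotMat θ • diagMat t • UpperHalfPlane.I := by
  rw [geodesic, ← mul_smul (frame p v)]
  rcases frame_turnCW p v θ with h | h
  · rw [h]
  · rw [h, neg_specialLinearGroup_smul]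

theorem exists_turnCW_eq {p : ℍ} (v w : UnitTangent p) : ∃ θ : ℝ, w = v.turnCW θ := by
  refine ⟨-(w.1 / v.1).arg, Subtype.ext ?_⟩
  have hpolar := Complex.norm_mul_exp_arg_mul_I (w.1 / v.1)
  rw [norm_div, v.2, w.2, div_self p.im_pos.ne', Complex.ofReal_one, one_mul] at hpolar
  change w.1 = Complex.exp (-(((-(w.1 / v.1).arg : ℝ) : ℂ) * Complex.I)) * v.1
  rw [Complex.ofReal_neg, neg_mul, neg_neg, hpolar, div_mul_cancel₀ _ v.ne_zero]

theorem cos_angle_turnCW {p : ℍ} (v : UnitTangent p) (θ : ℝ) :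
    Real.cos (InnerProductGeometry.angle v.1 (v.turnCW θ).1) = Real.cos θ := by
  have hinner : inner ℝ v.1 (v.turnCW θ).1 = Real.cos θ * (p.im * p.im) := by
    rw [Complex.inner, UnitTangent.turnCW, mul_assoc, Complex.mul_conj, Complex.normSq_eq_norm_sq,
      v.2, Complex.re_mul_ofReal, ← neg_mul, ← Complex.ofReal_neg, Complex.exp_ofReal_mul_I_re,
      Real.cos_neg, sq]
  rw [InnerProductGeometry.cos_angle, v.2, (v.turnCW θ).2, hinner,
    mul_div_cancel_right₀ _ (mul_self_pos.mpr p.im_pos.ne').ne']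

theorem dist_geodesic (a : ℍ) (u : UnitTangent a) {t : ℝ} (ht : 0 ≤ t) :
    dist a (geodesic a u t) = t := by
  obtain ⟨hisom, hzero⟩ := geodesic_isometry a u
  have := hisom.dist_eq 0 t
  rwa [hzero, Real.dist_eq, zero_sub, abs_neg, abs_of_nonneg ht] at this

theorem cosh_dist_geodesic_turnCW (a : ℍ) (u : UnitTangent a) (θ t t' : ℝ) :
    Real.cosh (dist (geodesic a u t) (geodesic a (u.turnCW θ) t')) =
      Real.cosh t * Real.cosh t' - Real.sinh t * Real.sinh t' * Real.cos θ := by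
  rw [← mul_div_cancel₀ θ (two_ne_zero (α := ℝ)), geodesic_turnCW, geodesic, dist_smul,
    cosh_dist_eq_lorentz, hyp_rotMat_smul_diagMat_smul_I, hyp_diagMat_smul, hyp_I, lorentz_apply]
  simp only [Matrix.cons_val]
  ring

theorem exists_rotMat_smul_diagMat_smul_I_eq (y : ℍ) :
    ∃ θ : ℝ, rotMat θ • diagMat (dist UpperHalfPlane.I y) • UpperHalfPlane.I = y := by
  have hcosh : Real.cosh (dist UpperHalfPlane.I y) = hyp y 0 := by
    rw [cosh_dist_eq_lorentz, hyp_I, lorentz_apply]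
    simp
  set w : ℂ := ⟨hyp y 1, hyp y 2⟩
  have hsinh : Real.sinh (dist UpperHalfPlane.I y) = ‖w‖ := by
    have hy := lorentz_hyp_self y
    rw [← sq_eq_sq₀ (Real.sinh_nonneg_iff.mpr dist_nonneg) (norm_nonneg w), Real.sinh_sq, hcosh,
      ← Complex.normSq_eq_norm_sq, Complex.normSq_apply]
    rw [lorentz_apply] at hy
    linear_combination hy
  refine ⟨w.arg / 2, hyp_injective ?_⟩
  rw [hyp_rotMat_smul_diagMat_smul_I, mul_div_cancel₀ _ two_ne_zero, hcosh, hsinh,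
    Complex.norm_mul_cos_arg, Complex.norm_mul_sin_arg]
  ext i
  fin_cases i <;> rfl

theorem exists_points {a b : ℍ} (hab : a ≠ b) : ∃ u : UnitTangent a, Points a u b := by
  let u : UnitTangent a := ⟨a.im, by rw [Complex.norm_real, Real.norm_of_nonneg a.im_pos.le]⟩
  obtain ⟨θ, hθ⟩ := exists_rotMat_smul_diagMat_smul_I_eq ((frame a u)⁻¹ • b)
  refine ⟨u.turnCW (2 * θ), _, dist_pos.mpr fun h => hab ?_,
    by rw [geodesic_turnCW, hθ, smul_inv_smul]⟩
  rw [← frame_smul_I a u, h, smul_inv_smul]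

theorem HasAngle.cosh_dist {a b c : ℍ} {α : ℝ} (h : HasAngle a b c α) :
    Real.cosh (dist b c) = Real.cosh (dist a b) * Real.cosh (dist a c) -
      Real.sinh (dist a b) * Real.sinh (dist a c) * Real.cos α := by
  obtain ⟨u, w, ⟨t, ht, rfl⟩, ⟨t', ht', rfl⟩, rfl⟩ := h
  obtain ⟨θ, rfl⟩ := exists_turnCW_eq u w
  rw [cos_angle_turnCW, cosh_dist_geodesic_turnCW, dist_geodesic _ _ ht.le,
    dist_geodesic _ _ ht'.le]

theorem HasAngle.mem_Icc {a b c : ℍ} {α : ℝ} (h : HasAngle a b c α) : α ∈ Set.Icc 0 Real.pi := by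
  obtain ⟨u, w, -, -, rfl⟩ := h
  exact ⟨InnerProductGeometry.angle_nonneg _ _, InnerProductGeometry.angle_le_pi _ _⟩

theorem hasAngle_of_cosh_dist {a b c : ℍ} {α : ℝ} (hab : a ≠ b) (hac : a ≠ c)
    (hα : α ∈ Set.Icc 0 Real.pi)
    (h : Real.cosh (dist b c) = Real.cosh (dist a b) * Real.cosh (dist a c) -
      Real.sinh (dist a b) * Real.sinh (dist a c) * Real.cos α) : HasAngle a b c α := by
  obtain ⟨u, hu⟩ := exists_points hab
  obtain ⟨w, hw⟩ := exists_points hac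
  have hangle : HasAngle a b c (InnerProductGeometry.angle u.1 w.1) := ⟨u, w, hu, hw, rfl⟩
  have hsinh : 0 < Real.sinh (dist a b) * Real.sinh (dist a c) :=
    mul_pos (Real.sinh_pos_iff.mpr (dist_pos.mpr hab)) (Real.sinh_pos_iff.mpr (dist_pos.mpr hac))
  have hcos : Real.cos (InnerProductGeometry.angle u.1 w.1) = Real.cos α :=
    mul_left_cancel₀ hsinh.ne' (by linarith [hangle.cosh_dist])
  rwa [← Real.injOn_cos hangle.mem_Icc hα hcos]

theorem HasAngle.ne_left {a b c : ℍ} {α : ℝ} (h : HasAngle a b c α) : a ≠ b := by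
  obtain ⟨u, -, ⟨t, ht, rfl⟩, -, -⟩ := h
  exact dist_pos.mp (by rwa [dist_geodesic _ _ ht.le])

theorem HasAngle.ne_right {a b c : ℍ} {α : ℝ} (h : HasAngle a b c α) : a ≠ c := by
  obtain ⟨-, w, -, ⟨t, ht, rfl⟩, -⟩ := h
  exact dist_pos.mp (by rwa [dist_geodesic _ _ ht.le])

theorem HasAngle.sin_nonneg {a b c : ℍ} {α : ℝ} (h : HasAngle a b c α) : 0 ≤ Real.sin α :=
  Real.sin_nonneg_of_mem_Icc h.mem_Icc

theorem HasAngle.sq_sin_mul_sinh_mul_sinh {a b c : ℍ} {α : ℝ} (h : HasAngle a b c α) :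
    (Real.sin α * (Real.sinh (dist a b) * Real.sinh (dist a c))) ^ 2 =
      1 + 2 * Real.cosh (dist a b) * Real.cosh (dist a c) * Real.cosh (dist b c) -
        Real.cosh (dist a b) ^ 2 - Real.cosh (dist a c) ^ 2 - Real.cosh (dist b c) ^ 2 := by
  rw [h.cosh_dist, mul_pow, mul_pow, Real.sin_sq]
  linear_combination (Real.sinh (dist a c) ^ 2) * Real.sinh_sq (dist a b) +
    (Real.cosh (dist a b) ^ 2 - 1) * Real.sinh_sq (dist a c)

theorem HasAngle.sin_mul_sinh_dist {p q s : ℍ} {α β : ℝ} (hp : HasAngle p q s α)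
    (hq : HasAngle q p s β) :
    Real.sin α * Real.sinh (dist p s) = Real.sin β * Real.sinh (dist q s) := by
  have hsinh : 0 < Real.sinh (dist p q) := Real.sinh_pos_iff.mpr (dist_pos.mpr hp.ne_left)
  have hnonneg {x y : ℍ} : 0 ≤ Real.sinh (dist x y) := Real.sinh_nonneg_iff.mpr dist_nonneg
  have hsq : (Real.sinh (dist p q) * (Real.sin α * Real.sinh (dist p s))) ^ 2 =
      (Real.sinh (dist p q) * (Real.sin β * Real.sinh (dist q s))) ^ 2 := by
    have hα := hp.sq_sin_mul_sinh_mul_sinh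
    have hβ := hq.sq_sin_mul_sinh_mul_sinh
    rw [dist_comm q p] at hβ
    linear_combination hα - hβ
  rw [sq_eq_sq₀ (mul_nonneg hnonneg (mul_nonneg hp.sin_nonneg hnonneg))
    (mul_nonneg hnonneg (mul_nonneg hq.sin_nonneg hnonneg))] at hsq
  exact mul_left_cancel₀ hsinh.ne' hsq

theorem HasAngle.sin_mul_sin_mul_cosh_dist {p q s : ℍ} {α β γ : ℝ} (hp : HasAngle p q s α)
    (hq : HasAngle q p s β) (hs : HasAngle s p q γ) :
    Real.sin α * Real.sin β * Real.cosh (dist p q) =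
      Real.cos γ + Real.cos α * Real.cos β := by
  have hsinh {x y : ℍ} (hxy : x ≠ y) : Real.sinh (dist x y) ≠ 0 :=
    (Real.sinh_pos_iff.mpr (dist_pos.mpr hxy)).ne'
  have hgram := hp.sq_sin_mul_sinh_mul_sinh
  have hsines := hp.sin_mul_sinh_dist hq
  have hcosα := hp.cosh_dist
  have hcosβ := hq.cosh_dist
  have hcosγ := hs.cosh_dist
  rw [dist_comm q p] at hcosβ
  rw [dist_comm s p, dist_comm s q] at hcosγ
  have hc := Real.sinh_sq (dist p q)
  refine mul_left_cancel₀ (mul_ne_zero (mul_ne_zero (hsinh hp.ne_right) (hsinh hq.ne_right))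
    (pow_ne_zero 2 (hsinh hp.ne_left))) ?_
  generalize Real.sinh (dist p q) = sc, Real.sinh (dist p s) = sb, Real.sinh (dist q s) = sa,
    Real.cosh (dist p q) = C, Real.cosh (dist p s) = B, Real.cosh (dist q s) = A at *
  have h1 : sb * sa * Real.cos γ = A * B - C := by linear_combination hcosγ
  have h2 : sc * sb * Real.cos α = B * C - A := by linear_combination hcosα
  have h3 : sc * sa * Real.cos β = A * C - B := by linear_combination hcosβ
  calc sb * sa * sc ^ 2 * (Real.sin α * Real.sin β * C)
      = (Real.sin α * sb) * (Real.sin β * sa) * sc ^ 2 * C := by ring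
    _ = (Real.sin α * (sc * sb)) ^ 2 * C := by rw [← hsines]; ring
    _ = (A * B - C) * (C ^ 2 - 1) + (B * C - A) * (A * C - B) := by rw [hgram]; ring
    _ = sb * sa * sc ^ 2 * (Real.cos γ + Real.cos α * Real.cos β) := by
      rw [← h1, ← h2, ← h3, ← hc]; ring

end Trigonometry

section PolygonTriangle

theorem HasAngle.symm {a b c : ℍ} {α : ℝ} (h : HasAngle a b c α) : HasAngle a c b α := by
  obtain ⟨u, w, hu, hw, rfl⟩ := h
  exact ⟨w, u, hw, hu, InnerProductGeometry.angle_comm _ _⟩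

theorem Points.geodesic_dist {a b : ℍ} {u : UnitTangent a} (h : Points a u b) :
    geodesic a u (dist a b) = b := by
  obtain ⟨t, ht, rfl⟩ := h
  rw [dist_geodesic a u ht.le]

theorem points_geodesic (a : ℍ) (u : UnitTangent a) {t : ℝ} (ht : 0 < t) :
    Points a u (geodesic a u t) :=
  ⟨t, ht, rfl⟩

/-- The distance from `p` to the apex `s` of `T_n`; it is determined by the right-angled triangle
that the altitude from `s` cuts off. -/
noncomputable def apexDistance (n : ℕ) : ℝ :=
  Real.arsinh (Real.sinh (sideLength n / 2) / Real.sin (Real.pi / n))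

variable {n : ℕ}

theorem pi_div_pos (hn : 5 ≤ n) : 0 < Real.pi / n :=
  div_pos Real.pi_pos (by positivity)

theorem two_mul_pi_div_lt (hn : 5 ≤ n) : 2 * (Real.pi / n) < Real.pi / 2 := by
  have hn' : (5 : ℝ) ≤ n := by exact_mod_cast hn
  have := Real.pi_pos
  rw [← mul_div_assoc, div_lt_div_iff₀ (by positivity) two_pos]
  nlinarith

theorem sin_pi_div_pos (hn : 5 ≤ n) : 0 < Real.sin (Real.pi / n) :=
  Real.sin_pos_of_pos_of_lt_pi (pi_div_pos hn) (by linarith [pi_div_pos hn, two_mul_pi_div_lt hn])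

theorem cos_pi_div_pos (hn : 5 ≤ n) : 0 < Real.cos (Real.pi / n) :=
  Real.cos_pos_of_mem_Ioo ⟨by linarith [pi_div_pos hn, Real.pi_pos],
    by linarith [pi_div_pos hn, two_mul_pi_div_lt hn]⟩

theorem cos_two_mul_pi_div_pos (hn : 5 ≤ n) : 0 < Real.cos (2 * Real.pi / n) := by
  rw [mul_div_assoc]
  exact Real.cos_pos_of_mem_Ioo ⟨by linarith [pi_div_pos hn, Real.pi_pos], two_mul_pi_div_lt hn⟩

theorem sideLength_pos (hn : 5 ≤ n) : 0 < sideLength n :=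
  Real.arcosh_pos (by linarith [cos_two_mul_pi_div_pos hn])

theorem cosh_sideLength (hn : 5 ≤ n) :
    Real.cosh (sideLength n) = 1 + 2 * Real.cos (2 * Real.pi / n) :=
  Real.cosh_arcosh (by linarith [cos_two_mul_pi_div_pos hn])

theorem cosh_half_sideLength (hn : 5 ≤ n) :
    Real.cosh (sideLength n / 2) = √2 * Real.cos (Real.pi / n) := by
  have hdouble := Real.cosh_two_mul (sideLength n / 2)
  rw [mul_div_cancel₀ _ two_ne_zero, cosh_sideLength hn, Real.sinh_sq, mul_div_assoc,
    Real.cos_two_mul] at hdouble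
  rw [← sq_eq_sq₀ (Real.cosh_pos _).le (mul_nonneg (Real.sqrt_nonneg 2) (cos_pi_div_pos hn).le),
    mul_pow, Real.sq_sqrt zero_le_two]
  linarith

theorem sinh_apexDistance_mul_sin (hn : 5 ≤ n) :
    Real.sinh (apexDistance n) * Real.sin (Real.pi / n) = Real.sinh (sideLength n / 2) := by
  rw [apexDistance, Real.sinh_arsinh, div_mul_cancel₀ _ (sin_pi_div_pos hn).ne']

theorem cosh_apexDistance_mul_sin (hn : 5 ≤ n) :
    Real.cosh (apexDistance n) * Real.sin (Real.pi / n) = Real.cos (Real.pi / n) := by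
  have hsinh := congrArg (· ^ 2) (sinh_apexDistance_mul_sin hn)
  have hcosh := congrArg (· ^ 2) (cosh_half_sideLength hn)
  simp only [mul_pow, Real.sinh_sq, Real.sin_sq, Real.sq_sqrt zero_le_two] at hsinh hcosh
  rw [← sq_eq_sq₀ (mul_pos (Real.cosh_pos _) (sin_pi_div_pos hn)).le (cos_pi_div_pos hn).le,
    mul_pow, Real.sin_sq]
  linarith

theorem apexDistance_pos (hn : 5 ≤ n) : 0 < apexDistance n :=
  Real.arsinh_pos_iff.mpr (div_pos
    (Real.sinh_pos_iff.mpr (half_pos (sideLength_pos hn))) (sin_pi_div_pos hn))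

theorem sinh_sideLength_mul_sinh_apexDistance (hn : 5 ≤ n) :
    Real.sinh (sideLength n) * Real.sinh (apexDistance n) * Real.cos (Real.pi / 4) =
      (Real.cosh (sideLength n) - 1) * Real.cosh (apexDistance n) := by
  have hdouble := Real.sinh_two_mul (sideLength n / 2)
  have hdouble' := Real.cosh_two_mul (sideLength n / 2)
  rw [mul_div_cancel₀ _ two_ne_zero] at hdouble hdouble'
  rw [hdouble, hdouble', Real.cosh_sq, cosh_half_sideLength hn, ← cosh_apexDistance_mul_sin hn,
    ← sinh_apexDistance_mul_sin hn, Real.cos_pi_div_four]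
  linear_combination (Real.sinh (apexDistance n) ^ 2 * Real.sin (Real.pi / n) ^ 2 *
    Real.cosh (apexDistance n)) * Real.sq_sqrt zero_le_two

theorem isPolygonTriangle_geodesic (hn : 5 ≤ n) (p : ℍ) (v : UnitTangent p) :
    IsPolygonTriangle n p v (geodesic p v (sideLength n))
      (geodesic p (v.turnCW (Real.pi / 4)) (apexDistance n)) := by
  set q := geodesic p v (sideLength n) with hq
  set s := geodesic p (v.turnCW (Real.pi / 4)) (apexDistance n) with hs
  have hpq : dist p q = sideLength n := dist_geodesic p v (sideLength_pos hn).le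
  have hps : dist p s = apexDistance n := dist_geodesic p _ (apexDistance_pos hn).le
  have hbase := sinh_sideLength_mul_sinh_apexDistance hn
  have hqs : dist q s = apexDistance n := by
    rw [← hps, dist_eq_dist_iff_lorentz, ← cosh_dist_eq_lorentz, ← cosh_dist_eq_lorentz, hps, hq,
      hs, cosh_dist_geodesic_turnCW, hbase]
    ring
  have hp_q : p ≠ q := dist_pos.mp (hpq ▸ sideLength_pos hn)
  have hp_s : p ≠ s := dist_pos.mp (hps ▸ apexDistance_pos hn)
  have hq_s : q ≠ s := dist_pos.mp (hqs ▸ apexDistance_pos hn)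
  have hquarter : Real.pi / 4 ∈ Set.Icc 0 Real.pi := by constructor <;> linarith [Real.pi_pos]
  have hapex : 2 * Real.pi / n ∈ Set.Icc 0 Real.pi := by
    rw [mul_div_assoc]
    constructor <;> linarith [pi_div_pos hn, two_mul_pi_div_lt hn, Real.pi_pos]
  refine ⟨points_geodesic p v (sideLength_pos hn), points_geodesic p _ (apexDistance_pos hn),
    ?_, ?_, ?_⟩
  · refine hasAngle_of_cosh_dist hp_q hp_s hquarter ?_
    rw [hpq, hps, hqs, hbase]
    ring
  · refine hasAngle_of_cosh_dist hp_q.symm hq_s hquarter ?_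
    rw [dist_comm q p, hpq, hps, hqs, hbase]
    ring
  · refine hasAngle_of_cosh_dist hp_s.symm hq_s.symm hapex ?_
    rw [dist_comm s p, dist_comm s q, hpq, hps, hqs, cosh_sideLength hn, mul_div_assoc,
      Real.cos_two_mul']
    linear_combination
      (Real.cos (Real.pi / n) ^ 2 - Real.sin (Real.pi / n) ^ 2) * Real.sinh_sq (apexDistance n) +
      (Real.cosh (apexDistance n) ^ 2 - 1) * Real.sin_sq_add_cos_sq (Real.pi / n) -
      2 * (Real.cosh (apexDistance n) * Real.sin (Real.pi / n) + Real.cos (Real.pi / n)) *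
        cosh_apexDistance_mul_sin hn

theorem IsPolygonTriangle.dist_eq_sideLength {p q s : ℍ} {v : UnitTangent p}
    (h : IsPolygonTriangle n p v q s) : dist p q = sideLength n := by
  have hlaw := h.angle_p.sin_mul_sin_mul_cosh_dist h.angle_q h.angle_s
  rw [Real.sin_pi_div_four, Real.cos_pi_div_four] at hlaw
  rw [← Real.arcosh_cosh (dist_nonneg (x := p)), sideLength]
  congr 1
  linear_combination 2 * hlaw + (1 - Real.cosh (dist p q)) / 2 * Real.sq_sqrt zero_le_two

theorem IsPolygonTriangle.dist_eq_apexDistance (hn : 5 ≤ n) {p q s : ℍ} {v : UnitTangent p}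
    (h : IsPolygonTriangle n p v q s) : dist p s = apexDistance n := by
  have hlaw := h.angle_p.symm.sin_mul_sin_mul_cosh_dist h.angle_s h.angle_q
  rw [Real.sin_pi_div_four, Real.cos_pi_div_four, mul_div_assoc, Real.sin_two_mul,
    Real.cos_two_mul] at hlaw
  have hpos : 0 < √2 * Real.cos (Real.pi / n) * Real.sin (Real.pi / n) := by
    have := cos_pi_div_pos hn
    have := sin_pi_div_pos hn
    positivity
  rw [← Real.arcosh_cosh (dist_nonneg (x := p)), ← Real.arcosh_cosh (apexDistance_pos hn).le]
  congr 1
  refine mul_left_cancel₀ hpos.ne' ?_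
  linear_combination hlaw - √2 * Real.cos (Real.pi / n) * cosh_apexDistance_mul_sin hn

theorem isPolygonTriangle_iff (hn : 5 ≤ n) {p q s : ℍ} {v : UnitTangent p} :
    IsPolygonTriangle n p v q s ↔ q = geodesic p v (sideLength n) ∧
      s = geodesic p (v.turnCW (Real.pi / 4)) (apexDistance n) := by
  constructor
  · intro h
    rw [← h.dist_eq_sideLength, ← h.dist_eq_apexDistance hn, h.dir_q.geodesic_dist,
      h.dir_s.geodesic_dist]
    exact ⟨rfl, rfl⟩
  · rintro ⟨rfl, rfl⟩
    exact isPolygonTriangle_geodesic hn p v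

end PolygonTriangle

section BaseTriangle

/-- The Coxeter matrix of the triangle with angles `π / 4`, `π / 2`, `π / n`: the half of `T_n` cut
off by the altitude from its apex. The walls `0`, `1`, `2` carry the side `[p, q]`, the side
`[p, s]` and the altitude. -/
def halfTriangleMatrix (n : ℕ) (hn : n ≠ 1) : CoxeterMatrix (Fin 3) where
  M := !![1, 4, 2; 4, 1, n; 2, n, 1]
  isSymm := by ext i j; fin_cases i <;> fin_cases j <;> rfl
  diagonal i := by fin_cases i <;> rfl
  off_diagonal i j hij := by fin_cases i <;> fin_cases j <;> simp_all

/-- Inward unit normals of the half triangle, for the copy of `T_n` with vertex `p = i` and initial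
direction `v` pointing upwards. -/
noncomputable def wallNormal (n : ℕ) : Fin 3 → Fin 3 → ℝ :=
  ![![0, 0, -1], ![0, -(√2 / 2), √2 / 2],
    ![Real.sinh (sideLength n / 2), Real.cosh (sideLength n / 2), 0]]

/-- The signed distance to a wall of the half triangle, or rather its hyperbolic sine. -/
noncomputable def wallForm (n : ℕ) (i : Fin 3) (z : ℍ) : ℝ := lorentz (wallNormal n i) (hyp z)

theorem wallForm_zero (n : ℕ) (z : ℍ) : wallForm n 0 z = hyp z 2 := by
  simp [wallForm, wallNormal, lorentz_apply]

theorem wallForm_one (n : ℕ) (z : ℍ) : wallForm n 1 z = √2 / 2 * (hyp z 1 - hyp z 2) := by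
  simp [wallForm, wallNormal, lorentz_apply, mul_sub]

theorem wallForm_two (n : ℕ) (z : ℍ) : wallForm n 2 z =
    Real.sinh (sideLength n / 2) * hyp z 0 - Real.cosh (sideLength n / 2) * hyp z 1 := by
  simp [wallForm, wallNormal, lorentz_apply]

theorem lorentz_wallNormal_self (n : ℕ) (i : Fin 3) :
    lorentz (wallNormal n i) (wallNormal n i) = -1 := by
  have hsq : √2 / 2 * (√2 / 2) = 1 / 2 := by
    linear_combination (1 / 4) * Real.mul_self_sqrt zero_le_two
  fin_cases i
  · simp [wallNormal, lorentz_apply]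
  · simp only [wallNormal, lorentz_apply, Fin.mk_one, Matrix.cons_val, neg_mul_neg, hsq]
    norm_num
  · simp only [wallNormal, lorentz_apply, Fin.reduceFinMk, Matrix.cons_val]
    linear_combination -Real.cosh_sq (sideLength n / 2)

/-- The reflection in a wall of the half triangle. -/
noncomputable def wallReflection (n : ℕ) (i : Fin 3) : ℍ ≃ᵢ ℍ :=
  hypReflection (wallNormal n i) (lorentz_wallNormal_self n i)

theorem hyp_wallReflection (n : ℕ) (i : Fin 3) (z : ℍ) :
    hyp (wallReflection n i z) = hyp z + (2 * wallForm n i z) • wallNormal n i :=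
  hyp_hypReflection _ z

theorem continuous_wallForm (n : ℕ) (i : Fin 3) : Continuous (wallForm n i) :=
  (LinearMap.continuous_of_finiteDimensional (lorentz (wallNormal n i))).comp continuous_hyp

theorem hyp_wallReflection_zero (n : ℕ) (z : ℍ) :
    hyp (wallReflection n 0 z) = ![hyp z 0, hyp z 1, -hyp z 2] := by
  rw [hyp_wallReflection, wallForm_zero]
  ext i
  fin_cases i <;> simp only [wallNormal, Pi.add_apply, Pi.smul_apply, smul_eq_mul, Fin.zero_eta,
    Fin.mk_one, Fin.reduceFinMk, Matrix.cons_val] <;> ring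

theorem hyp_wallReflection_one (n : ℕ) (z : ℍ) :
    hyp (wallReflection n 1 z) = ![hyp z 0, hyp z 2, hyp z 1] := by
  have hsq := Real.sq_sqrt (zero_le_two (α := ℝ))
  rw [hyp_wallReflection, wallForm_one]
  ext i
  fin_cases i <;> simp only [wallNormal, Pi.add_apply, Pi.smul_apply, smul_eq_mul, Fin.zero_eta,
    Fin.mk_one, Fin.reduceFinMk, Matrix.cons_val]
  · ring
  · linear_combination (hyp z 2 - hyp z 1) / 2 * hsq
  · linear_combination (hyp z 1 - hyp z 2) / 2 * hsq

theorem hyp_wallReflection_two (n : ℕ) (z : ℍ) : hyp (wallReflection n 2 z) =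
    ![Real.cosh (sideLength n) * hyp z 0 - Real.sinh (sideLength n) * hyp z 1,
      Real.sinh (sideLength n) * hyp z 0 - Real.cosh (sideLength n) * hyp z 1, hyp z 2] := by
  have hcosh := Real.cosh_two_mul (sideLength n / 2)
  have hsinh := Real.sinh_two_mul (sideLength n / 2)
  have hone := Real.cosh_sq (sideLength n / 2)
  rw [mul_div_cancel₀ _ two_ne_zero] at hcosh hsinh
  rw [hyp_wallReflection, wallForm_two, hcosh, hsinh]
  ext i
  fin_cases i <;> simp only [wallNormal, Pi.add_apply, Pi.smul_apply, smul_eq_mul, Fin.zero_eta,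
    Fin.mk_one, Fin.reduceFinMk, Matrix.cons_val]
  · linear_combination -hyp z 0 * hone
  · linear_combination -hyp z 1 * hone
  · ring

theorem moebius_rotMat_eq_wallReflection_mul (n : ℕ) :
    moebius (rotMat (Real.pi / 4)) = wallReflection n 1 * wallReflection n 0 := by
  refine IsometryEquiv.ext fun z => hyp_injective ?_
  have hturn : 2 * (Real.pi / 4) = Real.pi / 2 := by ring
  rw [IsometryEquiv.mul_apply, hyp_wallReflection_one, hyp_wallReflection_zero]
  change hyp (rotMat (Real.pi / 4) • z) = _
  rw [hyp_rotMat_smul, hturn, Real.cos_pi_div_two, Real.sin_pi_div_two]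
  simp

theorem moebius_diagMat_mul_moebius_rotMat_sq (n : ℕ) :
    moebius (diagMat (sideLength n)) * moebius (rotMat (Real.pi / 4)) ^ 2 =
      wallReflection n 0 * wallReflection n 2 := by
  refine IsometryEquiv.ext fun z => hyp_injective ?_
  rw [moebius_rotMat_eq_wallReflection_mul n, sq]
  change hyp (diagMat (sideLength n) • wallReflection n 1 (wallReflection n 0
    (wallReflection n 1 (wallReflection n 0 z)))) = hyp (wallReflection n 0 (wallReflection n 2 z))
  simp only [hyp_diagMat_smul, hyp_wallReflection_zero, hyp_wallReflection_one,
    hyp_wallReflection_two, Matrix.cons_val, mul_neg, ← sub_eq_add_neg]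

variable {n : ℕ}

theorem two_cos_pi_div (hn : 5 ≤ n) :
    2 * Real.cos (Real.pi / n) = √2 * Real.cosh (sideLength n / 2) := by
  rw [cosh_half_sideLength hn, ← mul_assoc, Real.mul_self_sqrt zero_le_two]

theorem lorentz_wallNormal (hn : 5 ≤ n) (i j : Fin 3) :
    lorentz (wallNormal n i) (wallNormal n j) =
      Real.cos (Real.pi / halfTriangleMatrix n (by lia) i j) := by
  wlog hij : i ≤ j generalizing i j
  · rw [lorentz_comm, this j i (le_of_not_ge hij), (halfTriangleMatrix n (by lia)).symmetric]
  rcases eq_or_ne i j with rfl | hne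
  · rw [lorentz_wallNormal_self, CoxeterMatrix.diagonal, Nat.cast_one, div_one, Real.cos_pi]
  obtain ⟨rfl, rfl⟩ | ⟨rfl, rfl⟩ | ⟨rfl, rfl⟩ :
      i = 0 ∧ j = 1 ∨ i = 0 ∧ j = 2 ∨ i = 1 ∧ j = 2 := by lia
  · simp [halfTriangleMatrix, wallNormal, lorentz_apply]
  · simp [halfTriangleMatrix, wallNormal, lorentz_apply]
  · simp only [halfTriangleMatrix, wallNormal, lorentz_apply, Matrix.cons_val, Matrix.of_apply]
    linear_combination -(two_cos_pi_div hn) / 2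

theorem reflectionSystem_wallReflection (hn : 5 ≤ n) :
    ReflectionSystem (halfTriangleMatrix n (by lia)) (wallReflection n) (wallForm n) := by
  refine reflectionSystem_hypReflection ?_ _ (lorentz_wallNormal hn) ?_
  · intro i j
    fin_cases i <;> fin_cases j <;> simp [halfTriangleMatrix] <;> lia
  · intro u hu
    have hsinh := Real.sinh_pos_iff.mpr (half_pos (sideLength_pos hn))
    have h0 : u 2 = 0 := by simpa [wallNormal, lorentz_apply] using hu 0
    have h1 : u 1 = 0 := by simpa [wallNormal, lorentz_apply, h0] using hu 1
    have h2 : u 0 = 0 := by simpa [wallNormal, lorentz_apply, h1, hsinh.ne'] using hu 2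
    ext i
    fin_cases i
    exacts [h2, h1, h0]

theorem exists_mem_chamber_wallForm (hn : 5 ≤ n) : ∃ x, x ∈ chamber (wallForm n) := by
  have hs : 0 < Real.sinh (sideLength n / 2) := Real.sinh_pos_iff.mpr (half_pos (sideLength_pos hn))
  set a := Real.sinh (sideLength n / 2) / Real.cosh (sideLength n / 2) / 2 with ha
  have ha0 : 0 < a := half_pos (div_pos hs (Real.cosh_pos _))
  set b := √(1 + a ^ 2 + (a / 2) ^ 2)
  have hb : b ^ 2 = 1 + a ^ 2 + (a / 2) ^ 2 := Real.sq_sqrt (by positivity)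
  have hb0 : 1 < b := Real.lt_sqrt_of_sq_lt (by nlinarith)
  obtain ⟨x, hx⟩ := exists_hyp_eq (u := ![b, a, a / 2]) (by simpa using one_pos.trans hb0) (by
    simp only [lorentz_apply, Matrix.cons_val]
    linear_combination hb)
  refine ⟨x, fun i => ?_⟩
  fin_cases i
  · simp [wallForm_zero, hx, ha0]
  · simp [wallForm_one, hx, ha0]
  · have hwall : Real.cosh (sideLength n / 2) * a = Real.sinh (sideLength n / 2) / 2 := by
      rw [ha]
      field_simp
    simp only [wallForm_two, hx, Fin.reduceFinMk, Matrix.cons_val, hwall]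
    nlinarith

theorem dist_wallReflection_lt {x : ℍ} (hx : x ∈ chamber (wallForm n)) (i : Fin 3) {z : ℍ}
    (hz : wallForm n i z < 0) : dist (wallReflection n i z) x < dist z x :=
  dist_hypReflection_lt _ (hx i) hz

/-- The turtle group `G_r` at the point `i` and the upward direction. -/
noncomputable def baseGroup (r : ℝ) : Subgroup (ℍ ≃ᵢ ℍ) :=
  Subgroup.closure {moebius (rotMat (Real.pi / 4)), moebius (diagMat r)}

theorem evenSubgroup_eq_baseGroup (hn : 5 ≤ n) :
    (reflectionSystem_wallReflection hn).evenSubgroup = baseGroup (sideLength n) := by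
  have hR := reflectionSystem_wallReflection hn
  have hrot := moebius_rotMat_eq_wallReflection_mul n
  have hdiag := moebius_diagMat_mul_moebius_rotMat_sq n
  apply le_antisymm
  · have hrot_mem : wallReflection n 1 * wallReflection n 0 ∈ baseGroup (sideLength n) :=
      hrot ▸ Subgroup.subset_closure (Set.mem_insert _ _)
    have hdiag_mem : wallReflection n 0 * wallReflection n 2 ∈ baseGroup (sideLength n) := by
      rw [← hdiag]
      exact mul_mem (Subgroup.subset_closure (Set.mem_insert_of_mem _ rfl))
        (pow_mem (Subgroup.subset_closure (Set.mem_insert _ _)) 2)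
    refine hR.evenSubgroup_le 2 fun i => ?_
    fin_cases i
    · exact hdiag_mem
    · have := mul_mem hrot_mem hdiag_mem
      rwa [mul_assoc, ← mul_assoc (wallReflection n 0), hR.mul_self, one_mul] at this
    · exact hR.mul_self 2 ▸ one_mem _
  · rw [baseGroup, Subgroup.closure_le, Set.insert_subset_iff, Set.singleton_subset_iff]
    have hrot_mem : moebius (rotMat (Real.pi / 4)) ∈ hR.evenSubgroup :=
      hrot ▸ hR.mul_mem_evenSubgroup 1 0
    refine ⟨hrot_mem, (Subgroup.mul_mem_cancel_right _ (pow_mem hrot_mem 2)).mp ?_⟩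
    exact hdiag ▸ hR.mul_mem_evenSubgroup 0 2

theorem hyp_apex (n : ℕ) : hyp (rotMat (Real.pi / 8) • diagMat (apexDistance n) • I) =
    ![Real.cosh (apexDistance n), √2 / 2 * Real.sinh (apexDistance n),
      √2 / 2 * Real.sinh (apexDistance n)] := by
  have hangle : 2 * (Real.pi / 8) = Real.pi / 4 := by ring
  rw [hyp_rotMat_smul_diagMat_smul_I, hangle, Real.cos_pi_div_four, Real.sin_pi_div_four,
    mul_comm]

theorem wallForm_two_apex (hn : 5 ≤ n) :
    wallForm n 2 (rotMat (Real.pi / 8) • diagMat (apexDistance n) • I) = 0 := by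
  have hcos := two_cos_pi_div hn
  have hsinh := sinh_apexDistance_mul_sin hn
  have hcosh := cosh_apexDistance_mul_sin hn
  rw [wallForm_two, hyp_apex]
  simp only [Matrix.cons_val]
  linear_combination Real.sinh (apexDistance n) * (hcos / 2 + hcosh) -
    Real.cosh (apexDistance n) * hsinh

theorem wallForm_one_add_wallForm_two_diagMat (hn : 5 ≤ n) :
    wallForm n 1 (diagMat (sideLength n) • I) +
      2 * Real.cos (Real.pi / n) * wallForm n 2 (diagMat (sideLength n) • I) = 0 := by
  have hsinh := Real.sinh_two_mul (sideLength n / 2)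
  have hsub := Real.sinh_sub (sideLength n) (sideLength n / 2)
  rw [mul_div_cancel₀ _ two_ne_zero] at hsinh
  rw [sub_half] at hsub
  rw [wallForm_one, wallForm_two, hyp_diagMat_smul, hyp_I, two_cos_pi_div hn]
  simp only [Matrix.cons_val]
  linear_combination √2 / 2 * hsinh + √2 * Real.cosh (sideLength n / 2) * hsub

theorem triangle_eq_doubledChamber (hn : 5 ≤ n) :
    triangle I (diagMat (sideLength n) • I) (rotMat (Real.pi / 8) • diagMat (apexDistance n) • I) =
      ReflectionSystem.doubledChamber (wallReflection n) (wallForm n) 2 := by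
  have hR := reflectionSystem_wallReflection hn
  let vertex : Fin 3 → ℍ :=
    ![I, diagMat (sideLength n) • I, rotMat (Real.pi / 8) • diagMat (apexDistance n) • I]
  let form : Fin 3 → Module.Dual ℝ (Fin 3 → ℝ) :=
    ![lorentz (wallNormal n 1) + (2 * Real.cos (Real.pi / n)) • lorentz (wallNormal n 2),
      lorentz (wallNormal n 1), lorentz (wallNormal n 0)]
  have happly (i) (z : ℍ) : form i (hyp z) =
      ![wallForm n 1 z + 2 * Real.cos (Real.pi / n) * wallForm n 2 z, wallForm n 1 z,
        wallForm n 0 z] i := by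
    fin_cases i <;> rfl
  have hpos (i) : 0 < form i (hyp (vertex i)) := by
    rw [happly]
    fin_cases i
    · simp [vertex, wallForm_one, wallForm_two, hyp_I, sideLength_pos hn, cos_pi_div_pos hn]
    · simp [vertex, wallForm_one, hyp_diagMat_smul, hyp_I, sideLength_pos hn]
    · simp [vertex, wallForm_zero, hyp_apex, apexDistance_pos hn]
  have hzero (i j) (hij : i ≠ j) : form i (hyp (vertex j)) = 0 := by
    rw [happly]
    fin_cases j <;> fin_cases i <;> first | exact absurd rfl hij | skip
    · simp [vertex, wallForm_one, hyp_I]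
    · simp [vertex, wallForm_zero, hyp_I]
    · exact wallForm_one_add_wallForm_two_diagMat hn
    · simp [vertex, wallForm_zero, hyp_diagMat_smul, hyp_I]
    · simp [vertex, wallForm_one, wallForm_two_apex hn, hyp_apex]
    · simp [vertex, wallForm_one, hyp_apex]
  ext z
  refine (mem_triangle_iff_forall_nonneg (v := vertex) hpos hzero).trans ?_
  rw [hR.mem_doubledChamber_iff]
  suffices h : (0 ≤ wallForm n 1 z + 2 * Real.cos (Real.pi / n) * wallForm n 2 z ∧
      0 ≤ wallForm n 1 z ∧ 0 ≤ wallForm n 0 z) ↔ 0 ≤ wallForm n 0 z ∧ 0 ≤ wallForm n 1 z ∧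
        0 ≤ wallForm n 1 z + 2 * Real.cos (Real.pi / n) * wallForm n 2 z by
    simpa [Fin.forall_fin_succ, happly, halfTriangleMatrix] using h
  tauto

end BaseTriangle

section Subgroups

theorem discreteTopology_of_forall_dist_lt {G : Subgroup IsomPlus} {x : ℍ} {ε : ℝ} (hε : 0 < ε)
    (hsep : ∀ g ∈ G, dist (g.1 x) x < ε → g = 1) : DiscreteTopology G := by
  have hval : Continuous fun (g : IsomPlus) (z : ℍ) => g.1 z := continuous_induced_dom
  have hcont : Continuous fun g : G => g.1.1 x :=
    (continuous_apply x).comp (hval.comp continuous_subtype_val)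
  rw [discreteTopology_iff_isOpen_singleton]
  intro g
  suffices (fun h : G => h.1.1 x) ⁻¹' Metric.ball (g.1.1 x) ε = {g} from
    this ▸ Metric.isOpen_ball.preimage hcont
  refine Set.eq_singleton_iff_unique_mem.mpr
    ⟨Set.mem_preimage.mpr (Metric.mem_ball_self hε), fun h hh => ?_⟩
  refine Subtype.ext (inv_mul_eq_one.mp (hsep _ (mul_mem (inv_mem g.2) h.2) ?_)).symm
  change dist ((g.1.1⁻¹ * h.1.1) x) x < ε
  rwa [IsometryEquiv.mul_apply, ← g.1.1.isometry.dist_eq, IsometryEquiv.apply_inv_self]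

theorem isFundDomain_of_forall {G : Subgroup IsomPlus} {P : Set ℍ}
    (hcover : ∀ z, ∃ g ∈ G, g.1 z ∈ P)
    (hdisj : ∀ g ∈ G, ∀ z ∈ P, g.1 z ∈ interior P → g = 1) : IsFundDomain G P where
  cover := by
    refine Set.eq_univ_of_forall fun z => ?_
    obtain ⟨g, hg, hgz⟩ := hcover z
    exact Set.mem_iUnion₂.mpr ⟨g⁻¹, inv_mem hg, _, hgz, g.1.inv_apply_self z⟩
  disjoint_interior g hg h hh hne := by
    rw [Set.disjoint_left]
    rintro _ ⟨z, hz, rfl⟩ hint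
    have hinterior : interior (translate h P) = h.1 '' interior P :=
      (h.1.toHomeomorph.image_interior P).symm
    rw [hinterior] at hint
    obtain ⟨y, hy, hyz⟩ := hint
    refine hne (inv_mul_eq_one.mp (hdisj _ (mul_mem (inv_mem hh) hg) z hz ?_)).symm
    have hgz : (h.1⁻¹ * g.1) z = y := by
      change h.1 y = g.1 z at hyz
      rw [IsometryEquiv.mul_apply, ← hyz, IsometryEquiv.inv_apply_self]
    exact hgz.symm ▸ hy

theorem map_mem_segment (φ : ℍ ≃ᵢ ℍ) {a b z : ℍ} : φ z ∈ segment (φ a) (φ b) ↔ z ∈ segment a b := by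
  simp only [segment, Set.mem_ofPred_eq, φ.isometry.dist_eq]

theorem triangle_image (φ : ℍ ≃ᵢ ℍ) (a b c : ℍ) :
    triangle (φ a) (φ b) (φ c) = φ '' triangle a b c := by
  ext z
  obtain ⟨z, rfl⟩ := φ.surjective z
  rw [φ.injective.mem_set_image, triangle, Set.mem_ofPred_eq, φ.surjective.exists]
  simp only [map_mem_segment]
  rfl

end Subgroups

section Transport

variable {G : Subgroup IsomPlus} {H : Subgroup (ℍ ≃ᵢ ℍ)} {φ : ℍ ≃ᵢ ℍ}

theorem conj_apply_apply (φ g : ℍ ≃ᵢ ℍ) (z : ℍ) : (MulAut.conj φ g) (φ z) = φ (g z) := by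
  rw [MulAut.conj_apply, IsometryEquiv.mul_apply, IsometryEquiv.mul_apply,
    IsometryEquiv.inv_apply_self]

theorem exists_conj_eq_of_mem (hGH : G.map IsomPlus.subtype = H.map (MulAut.conj φ).toMonoidHom)
    {g : IsomPlus} (hg : g ∈ G) : ∃ h ∈ H, MulAut.conj φ h = g.1 := by
  have hmem : g.1 ∈ G.map IsomPlus.subtype := ⟨g, hg, rfl⟩
  rwa [hGH] at hmem

theorem discreteTopology_of_map_conj
    (hGH : G.map IsomPlus.subtype = H.map (MulAut.conj φ).toMonoidHom) {x : ℍ} {ε : ℝ} (hε : 0 < ε)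
    (hsep : ∀ h ∈ H, dist (h x) x < ε → h = 1) : DiscreteTopology G := by
  refine discreteTopology_of_forall_dist_lt (x := φ x) hε fun g hg hdist => ?_
  obtain ⟨h, hh, hgh⟩ := exists_conj_eq_of_mem hGH hg
  rw [← hgh, conj_apply_apply, φ.isometry.dist_eq] at hdist
  exact Subtype.ext (by rw [← hgh, hsep h hh hdist, map_one]; rfl)

theorem isFundDomain_of_map_conj
    (hGH : G.map IsomPlus.subtype = H.map (MulAut.conj φ).toMonoidHom) {P : Set ℍ}
    (hcover : ∀ z, ∃ h ∈ H, h z ∈ P) (hdisj : ∀ h ∈ H, ∀ z ∈ P, h z ∈ interior P → h = 1) :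
    IsFundDomain G (φ '' P) := by
  have hinterior : interior (φ '' P) = φ '' interior P := (φ.toHomeomorph.image_interior P).symm
  refine isFundDomain_of_forall (fun z => ?_) ?_
  · obtain ⟨z, rfl⟩ := φ.surjective z
    obtain ⟨h, hh, hz⟩ := hcover z
    obtain ⟨g, hg, hgh⟩ : MulAut.conj φ h ∈ G.map IsomPlus.subtype := hGH ▸ ⟨h, hh, rfl⟩
    exact ⟨g, hg, h z, hz, by rw [← conj_apply_apply, ← hgh]; rfl⟩
  · rintro g hg _ ⟨z, hz, rfl⟩ hgz
    obtain ⟨h, hh, hgh⟩ := exists_conj_eq_of_mem hGH hg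
    rw [← hgh, conj_apply_apply, hinterior, φ.injective.mem_set_image] at hgz
    exact Subtype.ext (by rw [← hgh, hdisj h hh z hz hgz, map_one]; rfl)

theorem map_turtleGroup (p : ℍ) (v : UnitTangent p) (r : ℝ) :
    (turtleGroup p v r).map IsomPlus.subtype =
      (baseGroup r).map (MulAut.conj (moebius (frame p v))).toMonoidHom := by
  rw [turtleGroup, baseGroup, MonoidHom.map_closure, MonoidHom.map_closure, Set.image_pair,
    Set.image_pair]
  simp [quarterTurn, translation]

end Transport

section TurtleGroup

variable {n : ℕ}

theorem IsPolygonTriangle.triangle_eq_image (hn : 5 ≤ n) {p q s : ℍ} {v : UnitTangent p}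
    (h : IsPolygonTriangle n p v q s) : triangle p q s = moebius (frame p v) ''
      ReflectionSystem.doubledChamber (wallReflection n) (wallForm n) 2 := by
  obtain ⟨rfl, rfl⟩ := (isPolygonTriangle_iff hn).mp h
  have hangle : Real.pi / 4 = 2 * (Real.pi / 8) := by ring
  rw [← triangle_eq_doubledChamber hn, ← triangle_image, hangle, geodesic_turnCW]
  nth_rewrite 1 [← frame_smul_I p v]
  rfl

theorem exists_mem_baseGroup_apply_mem_doubledChamber (hn : 5 ≤ n) (z : ℍ) :
    ∃ h ∈ baseGroup (sideLength n),
      h z ∈ ReflectionSystem.doubledChamber (wallReflection n) (wallForm n) 2 := by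
  have hR := reflectionSystem_wallReflection hn
  obtain ⟨x, hx⟩ := exists_mem_chamber_wallForm hn
  obtain ⟨w, hw⟩ := hR.exists_hom_mem_closedChamber (continuous_wallForm n) hx
    (fun i _ => dist_wallReflection_lt hx i) z
  rw [← evenSubgroup_eq_baseGroup hn]
  exact hR.exists_mem_evenSubgroup_apply_mem_doubledChamber 2 hw

theorem eq_one_of_mem_baseGroup (hn : 5 ≤ n) {h : ℍ ≃ᵢ ℍ} (hh : h ∈ baseGroup (sideLength n))
    {z : ℍ} (hz : z ∈ ReflectionSystem.doubledChamber (wallReflection n) (wallForm n) 2)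
    (hhz : h z ∈ interior (ReflectionSystem.doubledChamber (wallReflection n) (wallForm n) 2)) :
    h = 1 := by
  have hR := reflectionSystem_wallReflection hn
  obtain ⟨x, hx⟩ := exists_mem_chamber_wallForm hn
  rw [← evenSubgroup_eq_baseGroup hn] at hh
  exact hR.eq_one_of_apply_mem_interior_doubledChamber 2 (closedChamber_subset_closure_chamber hx)
    hh hz hhz

theorem discreteTopology_turtleGroup (hn : 5 ≤ n) (p : ℍ) (v : UnitTangent p) :
    DiscreteTopology (turtleGroup p v (sideLength n)) := by
  have hR := reflectionSystem_wallReflection hn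
  obtain ⟨x, hx⟩ := exists_mem_chamber_wallForm hn
  obtain ⟨ε, hε, hsep⟩ := hR.exists_forall_dist_lt_imp_eq_one (continuous_wallForm n) hx
  rw [evenSubgroup_eq_baseGroup hn] at hsep
  exact discreteTopology_of_map_conj (map_turtleGroup p v _) hε hsep

end TurtleGroup

end HypTurtle

theorem mainTheorem4 (n : ℕ) (hn : 5 ≤ n) (p : UpperHalfPlane) (v : HypTurtle.UnitTangent p) :
    DiscreteTopology (HypTurtle.turtleGroup p v (HypTurtle.sideLength n)) ∧
    (∃ q s : UpperHalfPlane, HypTurtle.IsPolygonTriangle n p v q s) ∧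
    ∀ q s : UpperHalfPlane, HypTurtle.IsPolygonTriangle n p v q s →
      HypTurtle.IsFundDomain (HypTurtle.turtleGroup p v (HypTurtle.sideLength n))
        (HypTurtle.triangle p q s) := by
  refine ⟨HypTurtle.discreteTopology_turtleGroup hn p v,
    ⟨_, _, HypTurtle.isPolygonTriangle_geodesic hn p v⟩, fun q s hT => ?_⟩
  rw [hT.triangle_eq_image hn]
  exact HypTurtle.isFundDomain_of_map_conj (HypTurtle.map_turtleGroup p v _)
    (HypTurtle.exists_mem_baseGroup_apply_mem_doubledChamber hn)
    fun _ hh _ => HypTurtle.eq_one_of_mem_baseGroup hn hh
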